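/- Let $G=(V,E)$ be a connected, locally finite graph on which the simple random walk $(X_n)$ (law $P_x$ when started at $x$) is transient. Let $g(x,y)=\frac1{d(y)}\sum_{n\ge0}P_x[X_n=y]$ be its Green function ($d(y)$ is the degree of $y$), and let $\varphi=(\varphi_x)_{x\in V}$ be the Gaussian free field on $G$, i.e. the centred Gaussian process with covariance $g$, defined under $\mathbb P$. For a finite set $K\subset V$ let $\mathrm{cap}(K)=\sum_{x\in K}d(x)P_x[X_n\notin K\ \forall n\ge1]$ be its capacity, and let $\overline K$ be the union of $K$ and the set of all neighbours of points of $K$. For $h\in\mathbb R$ and a finite set $X\subset V$, let $\mathcal C_X(h)$ be the union of the connected components of $\{x:\varphi_x\ge h\}$ (with the induced adjacency) that intersect $X$; write $\mathcal C_o(h)=\mathcal C_{\{o\}}(h)$ for a fixed origin $o\in V$, and let $h_*=\sup\{h\in\mathbb R:\mathbb P[|\mathcal C_o(h)|=\infty]>0\}$. For $N\ge1$ put $$A_N^X(h)=\{|\mathcal C_X(h)|<\infty,\ N-1\le\mathrm{cap}(\overline{\mathcal C_X(h)})<N\}.$$ A sequence $(c_N)_{N\ge1}$ of positive numbers decays super-polynomially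 fast if $\log c_N/\log N\to-\infty$. Let $\widetilde h$ be the supremum of all $h\in(-\infty,h_*)$ such that for every finite $X\subset V$ there is a sequence $(c_N)$ decaying super-polynomially fast with $\mathbb P[A_N^X(h')]\le c_N$ for all $N\ge1$ and all $h'\le h$. Let $\hat h$ be the infimum of all $h\in(h_*,+\infty)$ such that for every finite $X\subset V$ there is a sequence $(c_N)$ decaying super-polynomially fast with $\mathbb P[A_N^X(h')]\le c_N$ for all $N\ge1$ and all $h'\ge h$. (Suprema and infima are taken in $[-\infty,+\infty]$, with $\sup\emptyset=-\infty$ and $\inf\emptyset=+\infty$.) **Theorem.** Let $F$ be a function from the finite subsets of $V$ to $\mathbb C$ of at most polynomial growth, i.e. for some constant $C\in(0,\infty)$, $|F(S)|\le C(1+\mathrm{cap}(\overline S))^C$ for all finite $S\subset V$, and let $X\subset V$ be finite. Then $\overline F^X(h)=\mathbb E\big[F(\mathcal C_X(h))\mathbf 1_{|\mathcal C_X(h)|<\infty}\big]$ is well defined (the random variable is integrable) for every $h\in\mathbb R\setminus[\widetilde h,\hat h]$, and $\overline F^X$ is $C^\infty$ on $\mathbb R\setminus[\widetilde h,\hat h]$.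 -/

import Mathlib

open MeasureTheory ProbabilityTheory Filter Topology Set

noncomputable section

namespace GFFPerc

/-! ### Simple random walk -/

section Walk

variable {V : Type*} (G : SimpleGraph V) [G.LocallyFinite]

/-- One step of the simple random walk: the uniform law on the neighbours of `x`.
(An isolated vertex, which does not occur in a connected transient graph, is absorbing.) -/
def step (x : V) : PMF V :=
  open Classical in
  if hx : (G.neighborFinset x).Nonempty then PMF.uniformOfFinset (G.neighborFinset x) hx
  else PMF.pure x

/-- The transition kernel of the simple random walk on trajectories: given the positions
`X_0, …, X_n`, the law of `X_{n+1}` is `step X_n`. The vertex set has the discrete σ-algebra. -/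
def stepKernel (n : ℕ) :
    @Kernel (∀ _ : Finset.Iic n, V) V (@MeasurableSpace.pi _ _ fun _ => ⊤) ⊤ :=
  letI : MeasurableSpace V := ⊤
  { toFun := fun p => (step G (p ⟨n, Finset.mem_Iic.2 le_rfl⟩)).toMeasure
    measurable' :=
      (measurable_from_top (f := fun x : V => (step G x).toMeasure)).comp
        (measurable_pi_apply (⟨n, Finset.mem_Iic.2 le_rfl⟩ : Finset.Iic n)) }

/-- The canonical law `P_x` on `ℕ → V` of the discrete-time simple random walk started at `x`. -/
def walkLaw (x : V) : @Measure (ℕ → V) (@MeasurableSpace.pi _ _ fun _ => ⊤) :=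
  letI : MeasurableSpace V := ⊤
  haveI : ∀ n, IsMarkovKernel (stepKernel G n) := fun n =>
    ⟨fun p => inferInstanceAs (IsProbabilityMeasure
      (step G (p ⟨n, Finset.mem_Iic.2 le_rfl⟩)).toMeasure)⟩
  Kernel.trajMeasure (X := fun _ => V) (Measure.dirac x) (stepKernel G)

/-- `P_x[X ∈ A]`, the probability that the trajectory of the walk from `x` lies in `A`. -/
def walkProb (x : V) (A : Set (ℕ → V)) : ℝ :=
  (walkLaw G x A).toReal

/-- `P_x[H̃_K = ∞]`: the walk from `x` is never in `K` at the times `n ≥ 1`. -/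
def escapeProb (K : Finset V) (x : V) : ℝ :=
  walkProb G x {ω | ∀ n, 1 ≤ n → ω n ∉ K}

/-- Transience of the simple random walk: from every vertex, the walk has positive probability of
never returning to it. -/
def IsTransient : Prop :=
  ∀ x : V, 0 < escapeProb G {x} x

/-- The Green function `g(x,y) = d(y)⁻¹ ∑_{n ≥ 0} P_x[X_n = y]`. -/
def green (x y : V) : ℝ :=
  (1 / (G.degree y : ℝ)) * ∑' n : ℕ, walkProb G x {ω | ω n = y}

/-- The capacity `cap(K) = ∑_{x ∈ K} d(x) P_x[H̃_K = ∞]` of a finite set `K`. -/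
def cap (K : Finset V) : ℝ :=
  ∑ x ∈ K, (G.degree x : ℝ) * escapeProb G K x

/-- The closure of a finite set `S`: the set `S` together with all neighbours of its points. -/
def vclosure (S : Finset V) : Finset V :=
  open Classical in S ∪ S.biUnion fun x => G.neighborFinset x

end Walk

/-! ### The Gaussian free field and its excursion sets -/

section Field

variable {V : Type*} (G : SimpleGraph V) {Ω : Type*} [MeasurableSpace Ω]

/-- `φ` is a Gaussian free field on `G` under `P`: a centred Gaussian process whose covariance is
the Green function. -/
structure IsGFF [G.LocallyFinite] (φ : V → Ω → ℝ) (P : Measure Ω) : Prop where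
  isGaussian : IsGaussianProcess φ P
  mean_zero : ∀ x, ∫ ω, φ x ω ∂P = 0
  covariance_eq : ∀ x y, cov[φ x, φ y; P] = green G x y

variable (φ : V → Ω → ℝ) (P : Measure Ω)

/-- The excursion set `{φ ≥ h}`. -/
def excursion (h : ℝ) (ω : Ω) : Set V := {x | h ≤ φ x ω}

/-- The cluster of `x` in the subgraph of `G` induced by `U`; it is empty if `x ∉ U`. -/
def cluster (U : Set V) (x : V) : Set V :=
  {y | ∃ (hx : x ∈ U) (hy : y ∈ U), (G.induce U).Reachable ⟨x, hx⟩ ⟨y, hy⟩}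

/-- `C_X(h)`: the union of the clusters of `{φ ≥ h}` that intersect `X`. -/
def clusterUnion (X : Finset V) (h : ℝ) (ω : Ω) : Set V :=
  ⋃ x ∈ X, cluster G (excursion φ h ω) x

/-- The percolation density `θ(h) = P[|C_o(h)| = ∞]`. -/
def theta (o : V) (h : ℝ) : ℝ :=
  P.real {ω | (cluster G (excursion φ h ω) o).Infinite}

/-- The critical point `h_* = sup {h ∈ ℝ : θ(h) > 0}`, as an extended real number. -/
def hStar (o : V) : EReal :=
  sSup ((fun h : ℝ => (h : EReal)) '' {h : ℝ | 0 < theta G φ P o h})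

/-- `F(C_X(h)) 1_{|C_X(h)| < ∞}`. -/
def observableValue (F : Finset V → ℂ) (X : Finset V) (h : ℝ) (ω : Ω) : ℂ :=
  open Classical in
  if hC : (clusterUnion G φ X h ω).Finite then F hC.toFinset else 0

/-- `F̄^X(h) = E[F(C_X(h)) 1_{|C_X(h)| < ∞}]`. -/
def FBar (F : Finset V → ℂ) (X : Finset V) (h : ℝ) : ℂ :=
  ∫ ω, observableValue G φ F X h ω ∂P

variable [G.LocallyFinite]

/-- The event `A^X_N(h)`: `C_X(h)` is finite and its closure has capacity in `[N - 1, N)`. -/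
def eventA (X : Finset V) (N : ℕ) (h : ℝ) : Set Ω :=
  {ω | ∃ hC : (clusterUnion G φ X h ω).Finite,
    (N : ℝ) - 1 ≤ cap G (vclosure G hC.toFinset) ∧ cap G (vclosure G hC.toFinset) < N}

/-- The sequence `c` decays super-polynomially fast: `log c_N / log N → -∞`. The terms are required
to be positive, so that the logarithm is the usual one. -/
def SuperPolyDecay (c : ℕ → ℝ) : Prop :=
  (∀ N, 0 < c N) ∧
    Tendsto (fun N : ℕ => Real.log (c N) / Real.log (N : ℝ)) atTop atBot

/-- For every finite `X`, the probabilities `P[A^X_N(h')]` decay super-polynomially fast in `N`,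
uniformly over the levels `h'` in `I`. -/
def UniformDecayOn (I : Set ℝ) : Prop :=
  ∀ X : Finset V, ∃ c : ℕ → ℝ, SuperPolyDecay c ∧
    ∀ N : ℕ, 1 ≤ N → ∀ h' ∈ I, P.real (eventA G φ X N h') ≤ c N

/-- The supercritical threshold `h̃`: the supremum of the levels `h < h_*` with super-polynomial
decay uniformly over all `h' ≤ h`. -/
def hTilde (o : V) : EReal :=
  sSup ((fun h : ℝ => (h : EReal)) ''
    {h : ℝ | (h : EReal) < hStar G φ P o ∧ UniformDecayOn G φ P (Iic h)})

/-- The subcritical threshold `ĥ`: the infimum of the levels `h > h_*` with super-polynomial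
decay uniformly over all `h' ≥ h`. -/
def hHat (o : V) : EReal :=
  sInf ((fun h : ℝ => (h : EReal)) ''
    {h : ℝ | hStar G φ P o < (h : EReal) ∧ UniformDecayOn G φ P (Ici h)})

/-- The set `ℝ ∖ [h̃, ĥ]`. -/
def offThresholds (o : V) : Set ℝ :=
  {h : ℝ | (h : EReal) ∉ Icc (hTilde G φ P o) (hHat G φ P o)}

end Field

/-- The observable `F` has at most polynomial growth in the capacity of the closure. The bound
`C (1 + cap)^C` is implied by `C cap^C`; unlike the latter it puts no constraint of smallness on
`F` at sets of small capacity such as `∅`, and so it allows constant observables. -/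
def PolyGrowth {V : Type*} (G : SimpleGraph V) [G.LocallyFinite] (F : Finset V → ℂ) : Prop :=
  ∃ C : ℝ, 0 < C ∧ ∀ S : Finset V, ‖F S‖ ≤ C * (1 + cap G (vclosure G S)) ^ C

end GFFPerc

end

noncomputable section

namespace GFFPerc

open scoped ENNReal NNReal

/-! ### Markov property of the simple random walk. -/

section WalkLaw

variable {V : Type*} (G : SimpleGraph V) [G.LocallyFinite]

/-! For a finite set `K`, whether `C_X(h) = K` is decided by the signs of `φ - h` on the finite set
`S = K̄ ∪ X`. Let `M` be `φ` integrated against the equilibrium measure of `S`. The equilibrium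
potential is `1` on `S`, so `M` has covariance `1` with every `φ_x`, `x ∈ S`, and variance `cap(S)`.
Shifting `φ` by `-h` on `S` is therefore a Cameron–Martin shift along `M`, and `P[C_X(h) = K] =
exp(-h² cap(S)/2) E[exp(-hM); C_X(0) = K]` (`IsGFF.measureReal_clusterEvent`).

The right-hand side is entire in `h`, and its modulus at `z` is at most `exp((Im z)² cap(S)/2)
P[C_X(Re z) = K]` (`IsGFF.norm_clusterProbExt_le`). This bound is linear in the probability, so it
can be summed over all `K` with `N ≤ cap(K̄) < N + 1`. The sum is an entire function controlled by
`P[A_{N+1}^X(Re z)]`, however many sets `K` there are.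

By subadditivity `cap(S) ≤ N + 1 + cap(X)`. On a disc of radius of order `1/N` about a real level
the exponential factor is bounded, so Cauchy's estimate gives an `n`-th derivative of order at most
`N^(C+n) P[A_{N+1}^X]`, the probability being taken at its worst over nearby levels
(`IsGFF.norm_iteratedDeriv_classExt_le`). Off `[h̃, ĥ]` these probabilities decay
super-polynomially, uniformly near the level. Hence the series of derivatives of every order
converge locally uniformly, which gives smoothness; the case `n = 0` gives integrability. -/

theorem isProbabilityMeasure_walkLaw (x : V) :
    @IsProbabilityMeasure _ (@MeasurableSpace.pi _ _ fun _ => ⊤) (walkLaw G x) := by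
  let _ : MeasurableSpace V := ⊤
  have : ∀ n, IsMarkovKernel (stepKernel G n) := fun n =>
    ⟨fun p => inferInstanceAs (IsProbabilityMeasure
      (step G (p ⟨n, Finset.mem_Iic.2 le_rfl⟩)).toMeasure)⟩
  unfold walkLaw
  infer_instance

theorem walkLaw_start (x : V) : walkLaw G x {ω | ω 0 = x} = 1 := by
  let _ : MeasurableSpace V := ⊤
  have : ∀ n, IsMarkovKernel (stepKernel G n) := fun n =>
    ⟨fun p => inferInstanceAs (IsProbabilityMeasure
      (step G (p ⟨n, Finset.mem_Iic.2 le_rfl⟩)).toMeasure)⟩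
  have h : (walkLaw G x).map (Preorder.frestrictLe 0)
      = (Measure.dirac x).map (MeasurableEquiv.piUnique (fun _ : Finset.Iic 0 => V)).symm := by
    unfold walkLaw
    rw [Kernel.trajMeasure, Measure.map_comp _ _ (by fun_prop), Kernel.traj_map_frestrictLe,
      Kernel.partialTraj_self, Measure.id_comp]
  have hS : MeasurableSet {p : Finset.Iic 0 → V | p ⟨0, by simp⟩ = x} :=
    measurable_pi_apply (X := fun _ : Finset.Iic 0 => V) ⟨0, by simp⟩
      (MeasurableSpace.measurableSet_top (s := {x}))
  have h2 := congrArg (fun μ => μ {p : Finset.Iic 0 → V | p ⟨0, by simp⟩ = x}) h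
  beta_reduce at h2
  rw [Measure.map_apply (Preorder.measurable_frestrictLe 0) hS,
    Measure.map_apply (MeasurableEquiv.measurable _) hS,
    Measure.dirac_apply' _ (MeasurableEquiv.measurable _ hS)] at h2
  refine Eq.trans ?_ (h2.trans ?_)
  · rfl
  · rw [indicator_of_mem]
    · rfl
    · rfl

theorem measurableSet_trajectory_eval (n : ℕ) (s : Set V) :
    @MeasurableSet _ (@MeasurableSpace.pi _ _ fun _ => ⊤) {ω : ℕ → V | ω n ∈ s} := by
  let _ : MeasurableSpace V := ⊤
  exact (measurable_pi_apply n) (MeasurableSpace.measurableSet_top (s := s))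

variable [Countable V]

/-- The one-step Markov property on events `B` that depend on the first `n` steps. -/
theorem walkLaw_inter_step (x : V) {n : ℕ} {B : Set (ℕ → V)}
    (hB : ∀ ω ω' : ℕ → V, (∀ i ≤ n, ω i = ω' i) → ω ∈ B → ω' ∈ B) (y z : V) :
    walkLaw G x (B ∩ {ω | ω n = y} ∩ {ω | ω (n + 1) = z})
      = walkLaw G x (B ∩ {ω | ω n = y}) * step G y z := by
  let _ : MeasurableSpace V := ⊤
  have : MeasurableSingletonClass V := ⟨fun _ => MeasurableSpace.measurableSet_top⟩
  have hk : ∀ n, IsMarkovKernel (stepKernel G n) := fun n =>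
    ⟨fun p => inferInstanceAs (IsProbabilityMeasure
      (step G (p ⟨n, Finset.mem_Iic.2 le_rfl⟩)).toMeasure)⟩
  have := isProbabilityMeasure_walkLaw G x
  have key : (walkLaw G x).map (Preorder.frestrictLe n) ⊗ₘ (stepKernel G n)
      = (walkLaw G x).map (fun ω => (Preorder.frestrictLe n ω, ω (n + 1))) := by
    unfold walkLaw
    exact Kernel.map_frestrictLe_trajMeasure_compProd_eq_map_trajMeasure
  -- The set of initial paths realising the event. There are countably many such paths, so it is
  -- measurable, and `hB` makes `B ∩ {ω n = y}` exactly its preimage.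
  set A : Set (Finset.Iic n → V) := Preorder.frestrictLe n '' (B ∩ {ω | ω n = y}) with hA
  have hpre : Preorder.frestrictLe (π := fun _ => V) n ⁻¹' A = B ∩ {ω | ω n = y} := by
    ext ω
    constructor
    · rintro ⟨ω', ⟨h1, h2⟩, h3⟩
      have h4 : ∀ i ≤ n, ω' i = ω i := fun i hi =>
        congrFun h3 ⟨i, Finset.mem_Iic.2 hi⟩
      exact ⟨hB _ _ h4 h1, (h4 n le_rfl).symm.trans h2⟩
    · exact fun h => ⟨ω, h, rfl⟩
  have hAm : MeasurableSet A := A.to_countable.measurableSet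
  have hzm : MeasurableSet ({z} : Set V) := MeasurableSpace.measurableSet_top
  have h2 := congrArg (fun μ => μ (A ×ˢ {z})) key
  beta_reduce at h2
  rw [Measure.compProd_apply_prod hAm hzm, Measure.map_apply (by fun_prop) (hAm.prod hzm)] at h2
  have h3 : (fun ω : ℕ → V => (Preorder.frestrictLe n ω, ω (n + 1))) ⁻¹' (A ×ˢ {z})
      = B ∩ {ω | ω n = y} ∩ {ω | ω (n + 1) = z} := by
    rw [← hpre]; rfl
  rw [h3] at h2
  rw [← h2, setLIntegral_congr_fun (g := fun _ => step G y z) hAm, setLIntegral_const,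
    Measure.map_apply (Preorder.measurable_frestrictLe n) hAm, hpre, mul_comm]
  rintro p ⟨ω, ⟨-, h5⟩, rfl⟩
  change (step G (ω n)).toMeasure {z} = _
  rw [show ω n = y from h5, PMF.toMeasure_apply_singleton _ _ hzm]

/-- The probability that the walk avoids `K` at the times `1, …, m`. -/
def avoidProb (K : Finset V) : ℕ → V → ℝ≥0∞
  | 0, _ => 1
  | m + 1, y => open Classical in ∑' z, step G y z * (if z ∈ K then 0 else avoidProb K m z)

/-- Induction on `m` for all `n` and `B` at once: after one step to `z ∉ K`, the event `B ∩ {ω n =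
y}` becomes the new past at time `n + 1`. -/
theorem walkLaw_inter_avoid (x : V) (K : Finset V) (m : ℕ) : ∀ {n : ℕ} {B : Set (ℕ → V)}
    (_ : ∀ ω ω' : ℕ → V, (∀ i ≤ n, ω i = ω' i) → ω ∈ B → ω' ∈ B) (y : V),
    walkLaw G x (B ∩ {ω | ω n = y} ∩ {ω | ∀ k, 1 ≤ k → k ≤ m → ω (n + k) ∉ K})
      = walkLaw G x (B ∩ {ω | ω n = y}) * avoidProb G K m y := by
  classical
  induction m with
  | zero =>
    intro n B hB y
    have : {ω : ℕ → V | ∀ k, 1 ≤ k → k ≤ 0 → ω (n + k) ∉ K} = univ :=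
      eq_univ_of_forall fun ω k h1 h2 => by omega
    rw [this, inter_univ, avoidProb, mul_one]
  | succ m ih =>
    intro n B hB y
    let _ : MeasurableSpace V := ⊤
    set E := B ∩ {ω | ω n = y} ∩ {ω : ℕ → V | ∀ k, 1 ≤ k → k ≤ m + 1 → ω (n + k) ∉ K} with hE
    have hB' : ∀ ω ω' : ℕ → V, (∀ i ≤ n + 1, ω i = ω' i) →
        ω ∈ B ∩ {ω | ω n = y} → ω' ∈ B ∩ {ω | ω n = y} := fun ω ω' h h1 =>
      ⟨hB ω ω' (fun i hi => h i (by omega)) h1.1, (h n (by omega)).symm.trans h1.2⟩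
    have hsum : walkLaw G x E = ∑' z, walkLaw G x (E ∩ {ω | ω (n + 1) = z}) := by
      have h := tsum_measure_preimage_singleton (μ := (walkLaw G x).restrict E)
        (f := fun ω : ℕ → V => ω (n + 1)) countable_univ
        fun z _ => measurableSet_trajectory_eval (n + 1) {z}
      rw [tsum_univ fun z => (walkLaw G x).restrict E ((fun ω : ℕ → V => ω (n + 1)) ⁻¹' {z}),
        preimage_univ, Measure.restrict_apply_univ] at h
      rw [← h]
      refine tsum_congr fun z => ?_
      refine (Measure.restrict_apply (measurableSet_trajectory_eval (n + 1) {z})).trans ?_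
      rw [inter_comm]
      rfl
    rw [hsum, avoidProb, ← ENNReal.tsum_mul_left]
    congr 1 with z
    split_ifs with hz
    · have : E ∩ {ω | ω (n + 1) = z} = ∅ := by
        ext ω
        simp only [mem_inter_iff, mem_empty_iff_false, iff_false]
        rintro ⟨⟨-, h⟩, h'⟩
        exact h 1 le_rfl (by omega) (by rw [show ω (n + 1) = z from h']; exact hz)
      simp [this]
    · rw [← mul_assoc, ← walkLaw_inter_step G x hB, ← ih hB']
      congr 1
      ext ω
      constructor
      · rintro ⟨⟨h1, h2⟩, h3⟩
        refine ⟨⟨h1, h3⟩, fun k hk hk' => ?_⟩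
        have := h2 (k + 1) (by omega) (by omega)
        rwa [show n + 1 + k = n + (k + 1) by omega]
      · rintro ⟨⟨h1, h3⟩, h2⟩
        refine ⟨⟨h1, fun k hk hk' => ?_⟩, h3⟩
        obtain rfl | h := eq_or_lt_of_le hk
        · rwa [show ω (n + 1) = z from h3]
        · have := h2 (k - 1) (by omega) (by omega)
          rwa [show n + 1 + (k - 1) = n + k by omega] at this

theorem walkLaw_avoid (y : V) (K : Finset V) (m : ℕ) :
    walkLaw G y {ω | ∀ k, 1 ≤ k → k ≤ m → ω k ∉ K} = avoidProb G K m y := by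
  let _ : MeasurableSpace V := ⊤
  have := isProbabilityMeasure_walkLaw G y
  have h := walkLaw_inter_avoid G y K m (n := 0) (B := univ) (fun _ _ _ _ => mem_univ _) y
  rw [univ_inter, walkLaw_start, one_mul] at h
  rw [← h, inter_comm]
  simp only [zero_add]
  refine (measure_inter_conull ?_).symm
  have h2 := prob_compl_eq_zero_iff (μ := walkLaw G y)
    (measurableSet_trajectory_eval 0 {y})
  rw [show {ω : ℕ → V | ω 0 = y} = {ω | ω 0 ∈ ({y} : Set V)} from rfl]
  rw [h2]
  exact walkLaw_start G y

/-- The Markov property at time `n` for the event of never visiting `K` again. -/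
theorem walkLaw_escape_after (x y : V) (K : Finset V) (n : ℕ) :
    walkLaw G x ({ω | ω n = y} ∩ {ω | ∀ k, 1 ≤ k → ω (n + k) ∉ K})
      = walkLaw G x {ω | ω n = y} * walkLaw G y {ω | ∀ k, 1 ≤ k → ω k ∉ K} := by
  let _ : MeasurableSpace V := ⊤
  have := isProbabilityMeasure_walkLaw G x
  have := isProbabilityMeasure_walkLaw G y
  have hm : ∀ n m, MeasurableSet {ω : ℕ → V | ∀ k, 1 ≤ k → k ≤ m → ω (n + k) ∉ K} := by
    intro n m
    simp only [ofPred_forall]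
    exact MeasurableSet.iInter fun k => MeasurableSet.iInter fun _ => MeasurableSet.iInter fun _ =>
      measurableSet_trajectory_eval (n + k) {z | z ∉ K}
  have hI : ∀ n, {ω : ℕ → V | ∀ k, 1 ≤ k → ω (n + k) ∉ K}
      = ⋂ m, {ω : ℕ → V | ∀ k, 1 ≤ k → k ≤ m → ω (n + k) ∉ K} := by
    intro n; ext ω
    simp only [mem_ofPred_eq, mem_iInter]
    exact ⟨fun h m k h1 _ => h k h1, fun h k h1 => h k k h1 le_rfl⟩
  have hanti : ∀ n, Antitone fun m => {ω : ℕ → V | ∀ k, 1 ≤ k → k ≤ m → ω (n + k) ∉ K} :=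
    fun n a b hab ω h k h1 h2 => h k h1 (h2.trans hab)
  have h1 : Tendsto (fun m => avoidProb G K m y) atTop
      (𝓝 (walkLaw G y {ω | ∀ k, 1 ≤ k → ω k ∉ K})) := by
    have h := tendsto_measure_iInter_atTop (μ := walkLaw G y)
      (fun m => (hm 0 m).nullMeasurableSet) (hanti 0) ⟨0, measure_ne_top _ _⟩
    rw [← hI 0] at h
    simp only [zero_add] at h
    refine h.congr fun m => walkLaw_avoid G y K m
  have h2 : Tendsto (fun m => walkLaw G x {ω | ω n = y} * avoidProb G K m y) atTop
      (𝓝 (walkLaw G x ({ω | ω n = y} ∩ {ω | ∀ k, 1 ≤ k → ω (n + k) ∉ K}))) := by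
    have hmy : MeasurableSet {ω : ℕ → V | ω n = y} := measurableSet_trajectory_eval n {y}
    have h := tendsto_measure_iInter_atTop (μ := walkLaw G x)
      (fun m => (hmy.inter (hm n m)).nullMeasurableSet)
      (fun a b hab => inter_subset_inter_right _ (hanti n hab)) ⟨0, measure_ne_top _ _⟩
    rw [← inter_iInter, ← hI n] at h
    refine h.congr fun m => ?_
    have := walkLaw_inter_avoid G x K m (n := n) (B := univ) (fun _ _ _ _ => mem_univ _) y
    rw [univ_inter] at this
    exact this
  exact tendsto_nhds_unique h2 (ENNReal.Tendsto.const_mul h1 (Or.inr (measure_ne_top _ _)))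

end WalkLaw

/-! ### Capacity, last-exit decomposition and equilibrium potential. -/

section Potential

variable {V : Type*} {G : SimpleGraph V} [G.LocallyFinite]

/-- Balls around a point are finite by local finiteness and exhaust the graph by connectedness.
Countability allows summation over all finite sets `K`. -/
theorem countable_of_connected (hconn : G.Connected) : Countable V := by
  classical
  obtain ⟨o⟩ := hconn.nonempty
  let B : ℕ → Finset V := fun n => (vclosure G)^[n] {o}
  have hB : ∀ v, ∃ n, v ∈ B n := by
    intro v
    have h := (SimpleGraph.reachable_iff_reflTransGen o v).1 (hconn.preconnected o v)
    induction h with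
    | refl => exact ⟨0, by simp [B]⟩
    | tail _ hab ih =>
      obtain ⟨n, hn⟩ := ih
      refine ⟨n + 1, ?_⟩
      simp only [B, Function.iterate_succ_apply', vclosure, Finset.mem_union, Finset.mem_biUnion]
      exact Or.inr ⟨_, hn, by simpa using hab⟩
  have : (⋃ n, (B n : Set V)) = univ := eq_univ_of_forall fun v => by
    simpa using hB v
  exact countable_univ_iff.1 (this ▸ countable_iUnion fun n => (B n).countable_toSet)

theorem measurableSet_escape_after (K : Finset V) (y : V) (n : ℕ) :
    @MeasurableSet _ (@MeasurableSpace.pi _ _ fun _ => ⊤)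
      ({ω : ℕ → V | ω n = y} ∩ {ω | ∀ k, 1 ≤ k → ω (n + k) ∉ K}) := by
  let _ : MeasurableSpace V := ⊤
  have hmy : MeasurableSet {ω : ℕ → V | ω n = y} := measurableSet_trajectory_eval n {y}
  refine hmy.inter ?_
  simp only [ofPred_forall]
  exact MeasurableSet.iInter fun k => MeasurableSet.iInter fun _ =>
      measurableSet_trajectory_eval (n + k) {z | z ∉ K}

/-- The index records the place and time of the last visit to `K`, which is unique. -/
theorem disjoint_escape_after (K : Finset V) {p q : K × ℕ} (hpq : p ≠ q) :
    Disjoint ({ω : ℕ → V | ω p.2 = p.1} ∩ {ω | ∀ k, 1 ≤ k → ω (p.2 + k) ∉ K})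
      ({ω : ℕ → V | ω q.2 = q.1} ∩ {ω | ∀ k, 1 ≤ k → ω (q.2 + k) ∉ K}) := by
  rw [Set.disjoint_left]
  rintro ω ⟨h1, h2⟩ ⟨h3, h4⟩
  simp only [mem_ofPred_eq] at h1 h2 h3 h4
  rcases lt_trichotomy p.2 q.2 with h | h | h
  · refine h2 (q.2 - p.2) (by omega) ?_
    rw [Nat.add_sub_cancel' h.le, h3]
    exact q.1.2
  · exact hpq (Prod.ext (Subtype.ext (by rw [← h1, ← h3, h])) h)
  · refine h4 (p.2 - q.2) (by omega) ?_
    rw [Nat.add_sub_cancel' h.le, h1]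
    exact p.1.2

/-- The equilibrium measure of `K` at `y`. -/
def equilibrium (G : SimpleGraph V) [G.LocallyFinite] (K : Finset V) (y : V) : ℝ :=
  (G.degree y : ℝ) * escapeProb G K y

theorem cap_eq_sum (K : Finset V) : cap G K = ∑ y ∈ K, equilibrium G K y := rfl

theorem equilibrium_nonneg (K : Finset V) (y : V) : 0 ≤ equilibrium G K y :=
  mul_nonneg (Nat.cast_nonneg _) ENNReal.toReal_nonneg

theorem cap_nonneg (K : Finset V) : 0 ≤ cap G K :=
  Finset.sum_nonneg fun y _ => equilibrium_nonneg K y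

theorem escapeProb_anti {K L : Finset V} (h : K ⊆ L) (y : V) :
    escapeProb G L y ≤ escapeProb G K y := by
  let _ : MeasurableSpace V := ⊤
  have := isProbabilityMeasure_walkLaw G y
  exact ENNReal.toReal_mono (measure_ne_top _ _)
    (measure_mono fun ω hω n hn hK => hω n hn (h hK))

/-- Enlarging a set lowers its escape probabilities, so the equilibrium measure of `K ∪ L` is
dominated by that of `K` on `K` and by that of `L` on `L`. -/
theorem cap_union_le [DecidableEq V] (K L : Finset V) :
    cap G (K ∪ L) ≤ cap G K + cap G L := by
  have hle : ∀ {A : Finset V}, A ⊆ K ∪ L →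
      ∑ y ∈ A, equilibrium G (K ∪ L) y ≤ cap G A := fun hA =>
    Finset.sum_le_sum fun y _ =>
      mul_le_mul_of_nonneg_left (escapeProb_anti hA y) (Nat.cast_nonneg _)
  calc cap G (K ∪ L) ≤ ∑ y ∈ K ∪ L, equilibrium G (K ∪ L) y
        + ∑ y ∈ K ∩ L, equilibrium G (K ∪ L) y :=
        le_add_of_nonneg_right (Finset.sum_nonneg fun y _ => equilibrium_nonneg _ y)
    _ = ∑ y ∈ K, equilibrium G (K ∪ L) y + ∑ y ∈ L, equilibrium G (K ∪ L) y :=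
        Finset.sum_union_inter
    _ ≤ _ := add_le_add (hle Finset.subset_union_left) (hle Finset.subset_union_right)

theorem escape_ne_zero (htrans : IsTransient G) (y : V) :
    walkLaw G y {ω | ∀ k, 1 ≤ k → ω k ∉ ({y} : Finset V)} ≠ 0 := by
  intro h
  have := htrans y
  rw [escapeProb, walkProb, h] at this
  simp at this

variable [Countable V]

/-- `step` makes an isolated vertex absorbing, which contradicts transience. This permits cancelling
the degree in `green` against the one in `equilibrium`. -/
theorem degree_ne_zero (htrans : IsTransient G) (x : V) : G.degree x ≠ 0 := by
  let _ : MeasurableSpace V := ⊤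
  have := isProbabilityMeasure_walkLaw G x
  intro hd
  have hstep : step G x x = 1 := by
    have : ¬ (G.neighborFinset x).Nonempty := by
      rw [← Finset.card_pos]; simpa using hd
    rw [step, dif_neg this]
    simp
  have h := walkLaw_inter_step G x (n := 0) (B := univ) (fun _ _ _ _ => mem_univ _) x x
  rw [univ_inter, walkLaw_start, hstep, one_mul] at h
  have h1 : walkLaw G x {ω | ω 1 = x} = 1 :=
    le_antisymm prob_le_one (h ▸ measure_mono fun ω hω => hω.2)
  have h2 := (prob_compl_eq_zero_iff (μ := walkLaw G x) (measurableSet_trajectory_eval 1 {x})).2 h1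
  have h3 : walkLaw G x {ω | ∀ n, 1 ≤ n → ω n ∉ ({x} : Finset V)} = 0 :=
    measure_mono_null (fun ω hω => by simpa using hω 1 le_rfl) h2
  have h4 := htrans x
  rw [escapeProb, walkProb, h3] at h4
  simp at h4

theorem tsum_walkLaw_mul_escape (x : V) (K : Finset V) :
    ∑' p : K × ℕ, walkLaw G x {ω | ω p.2 = p.1} *
        walkLaw G p.1 {ω | ∀ k, 1 ≤ k → ω k ∉ K}
      = walkLaw G x (⋃ p : K × ℕ,
        ({ω : ℕ → V | ω p.2 = p.1} ∩ {ω | ∀ k, 1 ≤ k → ω (p.2 + k) ∉ K})) := by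
  let _ : MeasurableSpace V := ⊤
  rw [measure_iUnion (fun p q hpq => disjoint_escape_after K hpq)
    fun p => measurableSet_escape_after K p.1 p.2]
  exact tsum_congr fun p => (walkLaw_escape_after G x p.1 K p.2).symm

/-- The last-exit decomposition for `K = {y}` bounds the expected number of visits times the
positive escape probability by `1`. -/
theorem tsum_walkLaw_ne_top (htrans : IsTransient G) (x y : V) :
    ∑' n : ℕ, walkLaw G x {ω | ω n = y} ≠ ∞ := by
  let _ : MeasurableSpace V := ⊤
  have := isProbabilityMeasure_walkLaw G x
  have h := tsum_walkLaw_mul_escape (G := G) x {y}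
  have h1 : ∑' n : ℕ, walkLaw G x {ω | ω n = y} *
      walkLaw G y {ω | ∀ k, 1 ≤ k → ω k ∉ ({y} : Finset V)} ≤ 1 := by
    have h2 : _ ≤ (1 : ℝ≥0∞) := h ▸ prob_le_one
    refine le_trans ?_ h2
    exact ENNReal.tsum_comp_le_tsum_of_injective
      (f := fun n : ℕ => ((⟨y, by simp⟩, n) : ({y} : Finset V) × ℕ))
      (fun a b hab => (Prod.ext_iff.1 hab).2) _
  rw [ENNReal.tsum_mul_right] at h1
  intro htop
  rw [htop, ENNReal.top_mul (escape_ne_zero htrans y)] at h1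
  simp at h1

/-- Borel–Cantelli at each of the finitely many points of `K`. -/
theorem ae_eventually_notMem (htrans : IsTransient G) (x : V) (K : Finset V) :
    walkLaw G x {ω | ∀ n, ∃ m, n ≤ m ∧ ω m ∈ K} = 0 := by
  let _ : MeasurableSpace V := ⊤
  have h : ∀ y, walkLaw G x {ω | ∃ᶠ n in atTop, ω n = y} = 0 := fun y =>
    measure_setOfPred_frequently_eq_zero (tsum_walkLaw_ne_top htrans x y)
  refine measure_mono_null (t := ⋃ y ∈ K, {ω | ∃ᶠ n in atTop, ω n = y}) ?_
    ((measure_biUnion_null_iff K.countable_toSet).2 fun y _ => h y)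
  intro ω hω
  by_contra hcon
  simp only [mem_iUnion, mem_ofPred_eq, not_exists, not_frequently] at hcon
  have h2 : ∀ᶠ n in atTop, ∀ y ∈ K, ω n ≠ y := (Finset.eventually_all K).2 hcon
  obtain ⟨n, hn⟩ := eventually_atTop.1 h2
  obtain ⟨m, hm, hmK⟩ := hω n
  exact hn m hm _ hmK rfl

theorem tsum_walkLaw_mul_escape_eq_one (htrans : IsTransient G) {x : V} {K : Finset V}
    (hx : x ∈ K) :
    ∑' p : K × ℕ, walkLaw G x {ω | ω p.2 = p.1} *
        walkLaw G p.1 {ω | ∀ k, 1 ≤ k → ω k ∉ K} = 1 := by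
  classical
  let _ : MeasurableSpace V := ⊤
  have := isProbabilityMeasure_walkLaw G x
  rw [tsum_walkLaw_mul_escape]
  set A := ⋃ p : K × ℕ, ({ω : ℕ → V | ω p.2 = p.1} ∩ {ω | ∀ k, 1 ≤ k → ω (p.2 + k) ∉ K})
  have hA : MeasurableSet A := MeasurableSet.iUnion fun p => measurableSet_escape_after K p.1 p.2
  rw [← prob_compl_eq_zero_iff hA]
  have h0 : walkLaw G x {ω : ℕ → V | ω 0 = x}ᶜ = 0 :=
    (prob_compl_eq_zero_iff (μ := walkLaw G x) (measurableSet_trajectory_eval 0 {x})).2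
      (walkLaw_start G x)
  refine measure_mono_null (t := {ω : ℕ → V | ω 0 = x}ᶜ ∪ {ω | ∀ n, ∃ m, n ≤ m ∧ ω m ∈ K}) ?_
    (measure_union_null h0 (ae_eventually_notMem htrans x K))
  intro ω hω
  by_contra hcon
  simp only [mem_union, mem_compl_iff, mem_ofPred_eq, not_or, not_not, not_forall, not_exists,
    not_and] at hcon
  obtain ⟨hx0, N, hN⟩ := hcon
  have hP0 : ω 0 ∈ K := by rwa [hx0]
  -- The last visit to `K` up to time `N` is the last visit altogether, since `K` is avoided from
  -- time `N` on.
  have hlast := Nat.findGreatest_spec (P := fun n => ω n ∈ K) (Nat.zero_le N) hP0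
  refine hω (mem_iUnion.2 ⟨(⟨_, hlast⟩, Nat.findGreatest (fun n => ω n ∈ K) N), rfl, ?_⟩)
  intro k hk hmem
  by_cases hle : Nat.findGreatest (fun n => ω n ∈ K) N + k ≤ N
  · have := Nat.le_findGreatest (P := fun n => ω n ∈ K) hle hmem
    omega
  · exact hN _ (by omega) hmem

/-- The equilibrium potential is `1` on `K`. -/
theorem sum_green_mul_equilibrium (htrans : IsTransient G) {x : V} {K : Finset V} (hx : x ∈ K) :
    ∑ y ∈ K, green G x y * equilibrium G K y = 1 := by
  let _ : MeasurableSpace V := ⊤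
  have := isProbabilityMeasure_walkLaw G x
  have h := tsum_walkLaw_mul_escape_eq_one htrans hx
  rw [ENNReal.tsum_prod', tsum_fintype] at h
  have h2 := congrArg ENNReal.toReal h
  simp_rw [ENNReal.tsum_mul_right] at h2
  rw [ENNReal.toReal_sum, ENNReal.toReal_one] at h2
  · rw [← h2, ← Finset.sum_coe_sort]
    refine Finset.sum_congr rfl fun y _ => ?_
    have hd : (G.degree (y : V) : ℝ) ≠ 0 := Nat.cast_ne_zero.2 (degree_ne_zero htrans y)
    rw [ENNReal.toReal_mul, ENNReal.tsum_toReal_eq fun n => measure_ne_top _ _]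
    simp only [green, equilibrium, escapeProb, walkProb]
    field_simp
  · intro y _
    have := isProbabilityMeasure_walkLaw G (y : V)
    exact ENNReal.mul_ne_top (tsum_walkLaw_ne_top htrans x y) (measure_ne_top _ _)

theorem cap_pos (htrans : IsTransient G) {K : Finset V} (hK : K.Nonempty) : 0 < cap G K := by
  refine lt_of_le_of_ne (cap_nonneg K) fun h => ?_
  obtain ⟨x, hx⟩ := hK
  have h1 := sum_green_mul_equilibrium htrans hx
  have h2 : ∀ y ∈ K, equilibrium G K y = 0 :=
    (Finset.sum_eq_zero_iff_of_nonneg fun y _ => equilibrium_nonneg K y).1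
      ((cap_eq_sum K).symm.trans h.symm)
  rw [Finset.sum_eq_zero fun y hy => by rw [h2 y hy, mul_zero]] at h1
  exact zero_ne_one h1

end Potential

/-! ### Cameron–Martin formula for finite Gaussian vectors. -/

section CameronMartin

/-- The exponential is the ratio of the densities of `N(tv, v)` and `N(0, v)`. -/
theorem lintegral_gaussianReal_add {v : ℝ≥0} (hv : v ≠ 0) (t : ℝ) {g : ℝ → ℝ≥0∞}
    (hg : Measurable g) :
    ∫⁻ m, g (m + t * v) ∂gaussianReal 0 v
      = ∫⁻ m, g m * ENNReal.ofReal (Real.exp (t * m - t ^ 2 * v / 2)) ∂gaussianReal 0 v := by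
  have hv' : (v : ℝ) ≠ 0 := by exact_mod_cast hv
  have h : ∫⁻ m, g (m + t * v) ∂gaussianReal 0 v = ∫⁻ m, g m ∂gaussianReal (t * v) v := by
    rw [← lintegral_map hg (by fun_prop), gaussianReal_map_add_const, zero_add]
  rw [h, gaussianReal_of_var_ne_zero _ hv, gaussianReal_of_var_ne_zero _ hv,
    lintegral_withDensity_eq_lintegral_mul _ (measurable_gaussianPDF _ _) hg,
    lintegral_withDensity_eq_lintegral_mul _ (measurable_gaussianPDF _ _) (by fun_prop)]
  refine lintegral_congr fun m => ?_
  simp only [Pi.mul_apply, gaussianPDF, gaussianPDFReal]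
  rw [mul_comm (g m), ← mul_assoc, ← ENNReal.ofReal_mul (by positivity), mul_assoc _ (Real.exp _),
    ← Real.exp_add]
  congr 5
  field_simp
  ring

variable {Ω : Type*} [MeasurableSpace Ω] {P : Measure Ω}

/-- The Cameron–Martin formula for a finite Gaussian vector `Y` shifted in the direction
`(1, …, 1)`, given a linear form `M` of `Y` that has covariance `1` with each coordinate. -/
theorem lintegral_gaussian_add_const {ι : Type*} [Fintype ι] {Y : ι → Ω → ℝ}
    (hY : HasGaussianLaw (fun ω i => Y i ω) P) (a : ι → ℝ) {v : ℝ≥0} (hv : v ≠ 0)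
    (hmean : ∫ ω, ∑ i, a i * Y i ω ∂P = 0)
    (hvar : Var[fun ω => ∑ i, a i * Y i ω; P] = v)
    (hcov : ∀ i, cov[Y i, fun ω => ∑ i, a i * Y i ω; P] = 1)
    {f : (ι → ℝ) → ℝ≥0∞} (hf : Measurable f) (t : ℝ) :
    ∫⁻ ω, f (fun i => Y i ω + t) ∂P = ∫⁻ ω, f (fun i => Y i ω) *
      ENNReal.ofReal (Real.exp (t * (∑ i, a i * Y i ω) - t ^ 2 * v / 2)) ∂P := by
  have := hY.isProbabilityMeasure
  have hv' : (v : ℝ) ≠ 0 := by exact_mod_cast hv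
  set M : Ω → ℝ := fun ω => ∑ i, a i * Y i ω with hM
  -- `ψ` is the part of `Y` uncorrelated with `M`, hence independent of it. As `Y i = ψ i + M / v`,
  -- adding `t` to every coordinate amounts to adding `t * v` to `M` with `ψ` fixed, which reduces
  -- the formula to dimension one.
  set ψ : ι → Ω → ℝ := fun i ω => Y i ω - M ω / v with hψ
  let ℓ : (ι → ℝ) →L[ℝ] ℝ := ∑ i, a i • ContinuousLinearMap.proj (R := ℝ) (φ := fun _ : ι => ℝ) i
  have hℓ : ∀ y, ℓ y = ∑ i, a i * y i := fun y => by simp [ℓ]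
  have hMlaw : HasGaussianLaw M P := (hY.map ℓ).congr (.of_forall fun ω => hℓ _)
  have hYi : ∀ i, HasGaussianLaw (Y i) P := fun i => hY.eval i
  let T : (ι → ℝ) →L[ℝ] (ι → ℝ) × (Unit → ℝ) :=
    (ContinuousLinearMap.pi fun i => ContinuousLinearMap.proj i - (v : ℝ)⁻¹ • ℓ).prod
      (ContinuousLinearMap.pi fun _ => ℓ)
  have hjoint : HasGaussianLaw (fun ω => (fun i => ψ i ω, fun _ : Unit => M ω)) P := by
    refine (hY.map T).congr (.of_forall fun ω => Prod.ext (funext fun i => ?_) (funext fun _ => ?_))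
    · simp [T, hℓ, hM, hψ, div_eq_inv_mul]
    · simp [T, hℓ, hM]
  have hindep : IndepFun (fun ω i => ψ i ω) M P := by
    have h := hjoint.indepFun_of_covariance_eval fun i _ => by
      have h1 : ψ i = Y i - fun ω => M ω / v := rfl
      have h2 : MemLp (fun ω => M ω / v) 2 P := by
        simpa only [div_eq_mul_inv] using hMlaw.memLp_two.mul_const ((v : ℝ)⁻¹)
      rw [h1, covariance_sub_left (hYi i).memLp_two h2 hMlaw.memLp_two, hcov i]
      simp only [div_eq_mul_inv]
      rw [covariance_mul_const_left, covariance_self hMlaw.aemeasurable, hvar,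
        mul_inv_cancel₀ hv', sub_self]
    exact h.comp measurable_id (measurable_pi_apply ())
  have hψm : AEMeasurable (fun ω i => ψ i ω) P := hjoint.fst.aemeasurable
  have hMm : AEMeasurable M P := hMlaw.aemeasurable
  have hmapM : P.map M = gaussianReal 0 v := by
    rw [hMlaw.map_eq_gaussianReal, hmean, hvar, Real.toNNReal_coe]
  have hmap : P.map (fun ω => (fun i => ψ i ω, M ω))
      = (P.map fun ω i => ψ i ω).prod (gaussianReal 0 v) := by
    rw [← hmapM, (indepFun_iff_map_prod_eq_prod_map_map hψm hMm).1 hindep]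
  have hpair : AEMeasurable (fun ω => ((fun i => ψ i ω), M ω)) P := hψm.prodMk hMm
  let g : (ι → ℝ) × ℝ → ℝ≥0∞ := fun p => f fun i => p.1 i + p.2 / v
  have hg : Measurable g := by
    refine hf.comp (measurable_pi_lambda _ fun i => ?_)
    fun_prop
  calc ∫⁻ ω, f (fun i => Y i ω + t) ∂P
      = ∫⁻ ω, (fun p : (ι → ℝ) × ℝ => g (p.1, p.2 + t * v)) (fun i => ψ i ω, M ω) ∂P := by
        refine lintegral_congr fun ω => ?_
        simp only [g, hψ]
        congr 1
        ext i
        field_simp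
        ring
    _ = ∫⁻ u, ∫⁻ m, g (u, m + t * v) ∂gaussianReal 0 v ∂(P.map fun ω i => ψ i ω) := by
        have hg' : Measurable fun p : (ι → ℝ) × ℝ => g (p.1, p.2 + t * v) := by fun_prop
        rw [← lintegral_map' hg'.aemeasurable hpair, hmap, lintegral_prod _ hg'.aemeasurable]
    _ = ∫⁻ u, ∫⁻ m, g (u, m) * ENNReal.ofReal (Real.exp (t * m - t ^ 2 * v / 2))
          ∂gaussianReal 0 v ∂(P.map fun ω i => ψ i ω) := by
        refine lintegral_congr fun u => ?_
        exact lintegral_gaussianReal_add hv t (g := fun m => g (u, m)) (by fun_prop)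
    _ = ∫⁻ ω, (fun p : (ι → ℝ) × ℝ => g p *
          ENNReal.ofReal (Real.exp (t * p.2 - t ^ 2 * v / 2))) (fun i => ψ i ω, M ω) ∂P := by
        have hg' : Measurable fun p : (ι → ℝ) × ℝ => g p *
          ENNReal.ofReal (Real.exp (t * p.2 - t ^ 2 * v / 2)) := by fun_prop
        rw [← lintegral_map' hg'.aemeasurable hpair, hmap, lintegral_prod _ hg'.aemeasurable]
    _ = _ := by
        refine lintegral_congr fun ω => ?_
        simp only [g, hψ]
        congr 2
        ext i
        ring

end CameronMartin

/-! ### The free field tested against the equilibrium measure. -/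

section GFF

variable {V : Type*} {G : SimpleGraph V} [G.LocallyFinite] {Ω : Type*} [MeasurableSpace Ω]
  {P : Measure Ω} {φ : V → Ω → ℝ}

/-- The field `φ` integrated against the equilibrium measure of `S`. -/
def equilibriumField (G : SimpleGraph V) [G.LocallyFinite] (φ : V → Ω → ℝ) (S : Finset V)
    (ω : Ω) : ℝ :=
  ∑ y ∈ S, equilibrium G S y * φ y ω

theorem IsGFF.memLp_two (hφ : IsGFF G φ P) (x : V) : MemLp (φ x) 2 P :=
  (hφ.isGaussian.hasGaussianLaw_eval x).memLp_two

theorem IsGFF.hasGaussianLaw_equilibriumField (hφ : IsGFF G φ P) (S : Finset V) :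
    HasGaussianLaw (equilibriumField G φ S) P := by
  have h := (hφ.isGaussian.smul (equilibrium G S)).hasGaussianLaw_fun_sum (I := S)
  exact h.congr (.of_forall fun ω => rfl)

theorem IsGFF.covariance_equilibriumField [Countable V] (htrans : IsTransient G)
    (hφ : IsGFF G φ P) {S : Finset V} {x : V} (hx : x ∈ S) :
    cov[φ x, equilibriumField G φ S; P] = 1 := by
  have := hφ.isGaussian.isProbabilityMeasure
  unfold equilibriumField
  rw [covariance_fun_sum_right' (fun y _ => (hφ.memLp_two y).const_mul _) (hφ.memLp_two x)]
  simp only [covariance_const_mul_right, hφ.covariance_eq]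
  simpa only [mul_comm] using sum_green_mul_equilibrium htrans hx

theorem IsGFF.variance_equilibriumField [Countable V] (htrans : IsTransient G)
    (hφ : IsGFF G φ P) (S : Finset V) :
    Var[equilibriumField G φ S; P] = cap G S := by
  have := hφ.isGaussian.isProbabilityMeasure
  rw [← covariance_self (hφ.hasGaussianLaw_equilibriumField S).aemeasurable]
  have h : cov[fun ω => ∑ y ∈ S, equilibrium G S y * φ y ω, equilibriumField G φ S; P]
      = cap G S := by
    rw [covariance_fun_sum_left' (fun y _ => (hφ.memLp_two y).const_mul _)
      (hφ.hasGaussianLaw_equilibriumField S).memLp_two, cap_eq_sum]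
    refine Finset.sum_congr rfl fun y hy => ?_
    rw [covariance_const_mul_left, hφ.covariance_equilibriumField htrans hy, mul_one]
  exact h

theorem IsGFF.lintegral_add_const [Countable V] (htrans : IsTransient G)
    (hφ : IsGFF G φ P) (S : Finset V) {f : (S → ℝ) → ℝ≥0∞} (hf : Measurable f) (t : ℝ) :
    ∫⁻ ω, f (fun i => φ i ω + t) ∂P = ∫⁻ ω, f (fun i => φ i ω) *
      ENNReal.ofReal (Real.exp (t * equilibriumField G φ S ω - t ^ 2 * cap G S / 2)) ∂P := by
  have := hφ.isGaussian.isProbabilityMeasure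
  -- For empty `S` the capacity vanishes and the formula with nonzero variance does not apply.
  obtain rfl | hS := S.eq_empty_or_nonempty
  · simp only [equilibriumField, cap_eq_sum, Finset.sum_empty, mul_zero, zero_div, sub_zero,
      Real.exp_zero, ENNReal.ofReal_one, mul_one]
    refine lintegral_congr fun ω => ?_
    congr 1
    ext i
    exact absurd i.2 (Finset.notMem_empty _)
  have hsum : ∀ ω, ∑ i : S, equilibrium G S i * φ i ω = equilibriumField G φ S ω := fun ω =>
    Finset.sum_coe_sort S fun y => equilibrium G S y * φ y ω
  have hsum' : (fun ω => ∑ i : S, equilibrium G S i * φ i ω) = equilibriumField G φ S :=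
    funext hsum
  have hc := cap_pos htrans hS
  have h := lintegral_gaussian_add_const (P := P) (Y := fun (i : S) => φ i)
    (hφ.isGaussian.hasGaussianLaw S) (fun i => equilibrium G S i)
    (v := (cap G S).toNNReal) (by simpa using hc)
    (by
      rw [hsum']
      unfold equilibriumField
      rw [integral_finsetSum _ fun y _ => ((hφ.memLp_two y).integrable one_le_two).const_mul _]
      simp [integral_const_mul, hφ.mean_zero])
    (by rw [hsum', hφ.variance_equilibriumField htrans, Real.coe_toNNReal _ hc.le])
    (fun i => by rw [hsum', hφ.covariance_equilibriumField htrans i.2])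
    hf t
  simpa only [hsum, Real.coe_toNNReal _ hc.le] using h

end GFF

/-! ### Clusters are determined by finitely many sites. -/

section Cluster

variable {V : Type*} (G : SimpleGraph V)

theorem mem_cluster_iff {U : Set V} {x y : V} :
    y ∈ cluster G U x ↔ x ∈ U ∧ Relation.ReflTransGen (fun a b => G.Adj a b ∧ b ∈ U) x y := by
  constructor
  · rintro ⟨hx, hy, h⟩
    refine ⟨hx, ?_⟩
    rw [SimpleGraph.reachable_iff_reflTransGen] at h
    exact h.lift (p := fun a b => G.Adj a b ∧ b ∈ U) Subtype.val fun a b hab => ⟨hab, b.2⟩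
  · rintro ⟨hx, h⟩
    induction h with
    | refl => exact ⟨hx, hx, SimpleGraph.Reachable.refl _⟩
    | tail _ hbc ih =>
      obtain ⟨hx', hb, h⟩ := ih
      refine ⟨hx', hbc.2, h.trans (SimpleGraph.Adj.reachable ?_)⟩
      exact hbc.1

/-- The union of the clusters of the set `U` that intersect `X`. -/
def clustersOf (X : Finset V) (U : Set V) : Set V := ⋃ x ∈ X, cluster G U x

theorem mem_clustersOf_iff {X : Finset V} {U : Set V} {y : V} :
    y ∈ clustersOf G X U ↔
      ∃ x ∈ X, x ∈ U ∧ Relation.ReflTransGen (fun a b => G.Adj a b ∧ b ∈ U) x y := by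
  simp only [clustersOf, mem_iUnion, mem_cluster_iff, exists_prop]

variable [G.LocallyFinite]

/-- The set of vertices whose states determine whether `K` is the union of the clusters
intersecting `X`. -/
def exploredSet (X K : Finset V) : Finset V :=
  open Classical in vclosure G K ∪ X

/-- The event that the clusters intersecting `X` have union `K` is determined by the states on
`exploredSet G X K`. -/
theorem clustersOf_eq_of_agree {X K : Finset V} {U U' : Set V}
    (hU : ∀ y ∈ exploredSet G X K, (y ∈ U ↔ y ∈ U')) (h : clustersOf G X U = K) :
    clustersOf G X U' = K := by
  classical
  have hX : ∀ x ∈ X, x ∈ exploredSet G X K := fun x hx => by simp [exploredSet, hx]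
  have hK : ∀ x ∈ K, x ∈ exploredSet G X K := fun x hx => by simp [exploredSet, vclosure, hx]
  have hN : ∀ x ∈ K, ∀ y, G.Adj x y → y ∈ exploredSet G X K := fun x hx y hxy => by
    simp only [exploredSet, vclosure, Finset.mem_union, Finset.mem_biUnion]
    exact Or.inl (Or.inr ⟨x, hx, by simpa using hxy⟩)
  have hmem : ∀ y, y ∈ K ↔
      ∃ x ∈ X, x ∈ U ∧ Relation.ReflTransGen (fun a b => G.Adj a b ∧ b ∈ U) x y := fun y => by
    rw [← mem_clustersOf_iff, h, Finset.mem_coe]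
  ext y
  rw [mem_clustersOf_iff, Finset.mem_coe]
  constructor
  -- A path in `U'` from `X` cannot leave `K`: its next vertex is a neighbour of `K`, where `U` and
  -- `U'` agree.
  · rintro ⟨x, hx, hxU, hpath⟩
    have hxU' := (hU x (hX x hx)).2 hxU
    induction hpath with
    | refl => exact (hmem x).2 ⟨x, hx, hxU', .refl⟩
    | tail _ hbc ih =>
      obtain ⟨x', hx', hxU', hp⟩ := (hmem _).1 ih
      exact (hmem _).2 ⟨x', hx', hxU', hp.tail ⟨hbc.1, (hU _ (hN _ ih _ hbc.1)).2 hbc.2⟩⟩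
  · intro hy
    obtain ⟨x, hx, hxU, hpath⟩ := (hmem y).1 hy
    refine ⟨x, hx, (hU x (hX x hx)).1 hxU, ?_⟩
    clear hy
    induction hpath with
    | refl => exact .refl
    | tail hab hbc ih =>
      exact ih.tail ⟨hbc.1, (hU _ (hK _ ((hmem _).2 ⟨x, hx, hxU, hab.tail hbc⟩))).1 hbc.2⟩

/-- The field configurations on `exploredSet G X K` for which `K` is the union of the clusters
of `{φ ≥ 0}` intersecting `X`. -/
def clusterConfig (X K : Finset V) : Set (exploredSet G X K → ℝ) :=
  {v | clustersOf G X {y | ∃ hy : y ∈ exploredSet G X K, 0 ≤ v ⟨y, hy⟩} = K}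

/-- The configuration enters only through its signs, which take finitely many values. -/
theorem measurableSet_clusterConfig (X K : Finset V) :
    MeasurableSet (clusterConfig G X K) := by
  let T : (exploredSet G X K → ℝ) → (exploredSet G X K → Prop) := fun v i => 0 ≤ v i
  have hT : Measurable T := by
    refine measurable_pi_lambda _ fun i => ?_
    exact measurableSet_setOfPred.1 (measurableSet_le measurable_const (measurable_pi_apply i))
  have hfin : MeasurableSet {q : exploredSet G X K → Prop |
      clustersOf G X {y | ∃ hy : y ∈ exploredSet G X K, q ⟨y, hy⟩} = K} :=
    (Set.toFinite _).measurableSet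
  exact hT hfin

variable {Ω : Type*} {φ : V → Ω → ℝ}

theorem clusterUnion_eq_iff {X K : Finset V} {h : ℝ} {ω : Ω} :
    clusterUnion G φ X h ω = K ↔
      (fun i : exploredSet G X K => φ i ω + -h) ∈ clusterConfig G X K := by
  have hag : ∀ y ∈ exploredSet G X K, (y ∈ excursion φ h ω ↔
      y ∈ {y | ∃ hy : y ∈ exploredSet G X K, 0 ≤ φ y ω + -h}) := fun y hy => by
    simp [excursion, hy]
  exact ⟨clustersOf_eq_of_agree G hag, clustersOf_eq_of_agree G fun y hy => (hag y hy).symm⟩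

end Cluster

/-! ### Entire extension of the probability of a given cluster. -/

section LevelProb

variable {V : Type*} {G : SimpleGraph V} [G.LocallyFinite] {Ω : Type*} [MeasurableSpace Ω]
  {P : Measure Ω} {φ : V → Ω → ℝ}

/-- The event `{C_X(h) = K}`. -/
def clusterEvent (G : SimpleGraph V) (φ : V → Ω → ℝ) (X K : Finset V) (h : ℝ) : Set Ω :=
  {ω | clusterUnion G φ X h ω = K}

theorem IsGFF.nullMeasurableSet_clusterEvent (hφ : IsGFF G φ P) (X K : Finset V) (h : ℝ) :
    NullMeasurableSet (clusterEvent G φ X K h) P := by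
  have hm : AEMeasurable (fun ω (i : exploredSet G X K) => φ i ω + -h) P :=
    aemeasurable_pi_lambda _ fun i =>
      (hφ.isGaussian.aemeasurable (i : V)).add_const _
  have := hm.nullMeasurableSet_preimage (measurableSet_clusterConfig G X K)
  convert this using 1
  ext ω
  exact clusterUnion_eq_iff G

/-- The weight `cap(K̄ ∪ X)` governing the dependence of `P[C_X(h) = K]` on `h`. -/
def exploredCap (G : SimpleGraph V) [G.LocallyFinite] (X K : Finset V) : ℝ :=
  cap G (exploredSet G X K)

theorem exploredCap_nonneg (X K : Finset V) : 0 ≤ exploredCap G X K := cap_nonneg _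

/-- The restriction of `P` to the event `{C_X(0) = K}`. -/
def clusterMeasure (G : SimpleGraph V) (φ : V → Ω → ℝ) (P : Measure Ω) (X K : Finset V) :
    Measure Ω :=
  P.restrict (clusterEvent G φ X K 0)

variable [Countable V]

/-- Cameron–Martin with test function `1`: the tilting density has total mass `1`. -/
theorem IsGFF.integrable_exp_equilibriumField (htrans : IsTransient G) (hφ : IsGFF G φ P)
    (S : Finset V) (t : ℝ) :
    Integrable (fun ω => Real.exp (t * equilibriumField G φ S ω)) P := by
  have := hφ.isGaussian.isProbabilityMeasure
  have hm := (hφ.hasGaussianLaw_equilibriumField S).aemeasurable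
  have h := hφ.lintegral_add_const htrans S (f := fun _ => 1) measurable_const t
  have hi : Integrable (fun ω => Real.exp (t * equilibriumField G φ S ω - t ^ 2 * cap G S / 2)) P := by
    refine ⟨by fun_prop, ?_⟩
    rw [hasFiniteIntegral_iff_ofReal (.of_forall fun ω => (Real.exp_pos _).le)]
    simp only [one_mul] at h
    rw [← h]
    simp
  refine (hi.mul_const (Real.exp (t ^ 2 * cap G S / 2))).congr (.of_forall fun ω => ?_)
  simp only
  rw [← Real.exp_add, sub_add_cancel]

/-- Level `h` for `φ` is level `0` for `φ - h`, so the constant shift by `-h` moves the whole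
dependence on `h` into an exponential weight on a fixed event. -/
theorem IsGFF.measureReal_clusterEvent (htrans : IsTransient G) (hφ : IsGFF G φ P)
    (X K : Finset V) (h : ℝ) :
    P.real (clusterEvent G φ X K h) = Real.exp (-(h ^ 2 * exploredCap G X K / 2)) *
      mgf (equilibriumField G φ (exploredSet G X K)) (clusterMeasure G φ P X K) (-h) := by
  have := hφ.isGaussian.isProbabilityMeasure
  set S := exploredSet G X K
  have hB := measurableSet_clusterConfig G X K
  have hm := (hφ.hasGaussianLaw_equilibriumField S).aemeasurable
  have hE : ∀ h, clusterEvent G φ X K h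
      = {ω | (fun i : S => φ i ω + -h) ∈ clusterConfig G X K} := fun h =>
    Set.ext fun ω => clusterUnion_eq_iff G
  have hnull := hφ.nullMeasurableSet_clusterEvent X K
  have key := hφ.lintegral_add_const htrans S
    (f := (clusterConfig G X K).indicator 1) (measurable_one.indicator hB) (-h)
  have h1 : ∫⁻ ω, (clusterConfig G X K).indicator 1 (fun i : S => φ i ω + -h) ∂P
      = P (clusterEvent G φ X K h) := by
    rw [← lintegral_indicator_one₀ (hnull h), hE h]
    rfl
  have h2 : ∫⁻ ω, (clusterConfig G X K).indicator 1 (fun i : S => φ i ω) *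
        ENNReal.ofReal (Real.exp (-h * equilibriumField G φ S ω - (-h) ^ 2 * cap G S / 2)) ∂P
      = ∫⁻ ω, ENNReal.ofReal (Real.exp (-h * equilibriumField G φ S ω - (-h) ^ 2 * cap G S / 2))
        ∂(clusterMeasure G φ P X K) := by
    rw [clusterMeasure, ← lintegral_indicator₀ (hnull 0), hE 0]
    refine lintegral_congr fun ω => ?_
    by_cases hω : (fun i : S => φ i ω) ∈ clusterConfig G X K <;> simp [indicator, hω]
  rw [h1, h2] at key
  rw [measureReal_def, key, mgf, ← integral_const_mul, ← integral_toReal]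
  · refine integral_congr_ae (.of_forall fun ω => ?_)
    simp only
    rw [ENNReal.toReal_ofReal (Real.exp_pos _).le, ← Real.exp_add]
    congr 1
    simp only [exploredCap]
    ring
  · have : AEMeasurable (equilibriumField G φ S) (clusterMeasure G φ P X K) :=
      hm.mono_measure Measure.restrict_le_self
    fun_prop
  · simp

/-- The entire extension of `h ↦ P[C_X(h) = K]`. -/
def clusterProbExt (G : SimpleGraph V) [G.LocallyFinite] (φ : V → Ω → ℝ) (P : Measure Ω)
    (X K : Finset V) (z : ℂ) : ℂ :=
  Complex.exp (-(z ^ 2 * exploredCap G X K / 2)) *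
    complexMGF (equilibriumField G φ (exploredSet G X K)) (clusterMeasure G φ P X K) (-z)

theorem IsGFF.integrableExpSet_equilibriumField (htrans : IsTransient G) (hφ : IsGFF G φ P)
    (X K : Finset V) :
    integrableExpSet (equilibriumField G φ (exploredSet G X K)) (clusterMeasure G φ P X K)
      = univ :=
  eq_univ_of_forall fun t =>
    (hφ.integrable_exp_equilibriumField htrans (exploredSet G X K) t).mono_measure
      Measure.restrict_le_self

theorem IsGFF.differentiable_clusterProbExt (htrans : IsTransient G) (hφ : IsGFF G φ P)
    (X K : Finset V) : Differentiable ℂ (clusterProbExt G φ P X K) := by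
  have h : Differentiable ℂ (complexMGF (equilibriumField G φ (exploredSet G X K))
      (clusterMeasure G φ P X K)) := fun z =>
    (hasDerivAt_complexMGF (by
      simp [hφ.integrableExpSet_equilibriumField htrans X K])).differentiableAt
  unfold clusterProbExt
  exact Differentiable.mul (by fun_prop) (h.comp differentiable_neg)

theorem IsGFF.clusterProbExt_ofReal (htrans : IsTransient G) (hφ : IsGFF G φ P)
    (X K : Finset V) (h : ℝ) :
    clusterProbExt G φ P X K h = (P.real (clusterEvent G φ X K h) : ℂ) := by
  rw [hφ.measureReal_clusterEvent htrans, clusterProbExt, ← Complex.ofReal_neg,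
    complexMGF_ofReal]
  push_cast
  rfl

/-- Only the real part of `z` contributes to the modulus of `exp(-zM)`. The Gaussian prefactor
contains `Re(z²) = (Re z)² - (Im z)²`, and the second term is the whole loss. -/
theorem IsGFF.norm_clusterProbExt_le (htrans : IsTransient G) (hφ : IsGFF G φ P)
    (X K : Finset V) (z : ℂ) :
    ‖clusterProbExt G φ P X K z‖ ≤ Real.exp (z.im ^ 2 * exploredCap G X K / 2) *
      P.real (clusterEvent G φ X K z.re) := by
  rw [hφ.measureReal_clusterEvent htrans, clusterProbExt, norm_mul, ← mul_assoc, ← Real.exp_add,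
    Complex.norm_exp]
  refine mul_le_mul (le_of_eq ?_) ?_ (norm_nonneg _) (Real.exp_pos _).le
  · congr 1
    have : (-(z ^ 2 * (exploredCap G X K : ℂ) / 2)).re
        = -((z.re ^ 2 - z.im ^ 2) * exploredCap G X K / 2) := by
      rw [show -(z ^ 2 * (exploredCap G X K : ℂ) / 2)
        = ((-(exploredCap G X K / 2) : ℝ) : ℂ) * z ^ 2 by push_cast; ring,
        Complex.re_ofReal_mul, pow_two, Complex.mul_re]
      ring
    rw [this]
    ring
  · simpa using norm_complexMGF_le_mgf (X := equilibriumField G φ (exploredSet G X K))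
      (μ := clusterMeasure G φ P X K) (z := -z)

/-- Uses `exp(-sm) ≤ exp(-am) + exp(am)`. The bound no longer depends on `s`, so it serves as a
summable majorant on bounded sets of `z`. -/
theorem IsGFF.measureReal_clusterEvent_le_of_abs_le (htrans : IsTransient G) (hφ : IsGFF G φ P)
    (X K : Finset V) {s a : ℝ} (hs : |s| ≤ a) :
    P.real (clusterEvent G φ X K s) ≤ Real.exp (a ^ 2 * exploredCap G X K / 2) *
      (P.real (clusterEvent G φ X K a) + P.real (clusterEvent G φ X K (-a))) := by
  have hc := exploredCap_nonneg (G := G) X K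
  rw [hφ.measureReal_clusterEvent htrans X K s, hφ.measureReal_clusterEvent htrans X K a,
    hφ.measureReal_clusterEvent htrans X K (-a), neg_neg, neg_sq, ← mul_add, ← mul_assoc,
    ← Real.exp_add, add_neg_cancel, Real.exp_zero, one_mul]
  have hint : ∀ t, Integrable
      (fun ω => Real.exp (t * equilibriumField G φ (exploredSet G X K) ω))
      (clusterMeasure G φ P X K) := fun t => by
    have : t ∈ integrableExpSet (equilibriumField G φ (exploredSet G X K))
      (clusterMeasure G φ P X K) := by simp [hφ.integrableExpSet_equilibriumField htrans X K]
    exact this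
  have h1 : mgf (equilibriumField G φ (exploredSet G X K)) (clusterMeasure G φ P X K) (-s)
      ≤ mgf (equilibriumField G φ (exploredSet G X K)) (clusterMeasure G φ P X K) (-a)
        + mgf (equilibriumField G φ (exploredSet G X K)) (clusterMeasure G φ P X K) a := by
    unfold mgf
    rw [← integral_add (hint _) (hint _)]
    refine integral_mono (hint _) ((hint _).add (hint _)) fun ω => ?_
    simp only
    set m := equilibriumField G φ (exploredSet G X K) ω
    obtain ⟨h3, h4⟩ := abs_le.1 hs
    rcases le_total 0 m with hm | hm
    · exact (Real.exp_le_exp.2 (mul_le_mul_of_nonneg_right (by linarith) hm)).trans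
        (le_add_of_nonneg_left (Real.exp_pos _).le)
    · exact (Real.exp_le_exp.2 (mul_le_mul_of_nonpos_right (by linarith) hm)).trans
        (le_add_of_nonneg_right (Real.exp_pos _).le)
  refine (mul_le_of_le_one_left mgf_nonneg ?_).trans h1
  rw [Real.exp_le_one_iff]
  have := mul_nonneg (sq_nonneg s) hc
  linarith

end LevelProb

/-! ### Smoothness of series and super-polynomial decay. -/

section Analysis

theorem contDiffOn_of_hasDerivAt_succ {s : Set ℝ} (hs : IsOpen s) {g : ℕ → ℝ → ℂ}
    (hg : ∀ n, ∀ x ∈ s, HasDerivAt (g n) (g (n + 1) x) x) : ContDiffOn ℝ (⊤ : ℕ∞) (g 0) s := by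
  rw [contDiffOn_infty]
  have h : ∀ m n : ℕ, ContDiffOn ℝ m (g n) s := by
    intro m
    induction m with
    | zero =>
      exact fun n => contDiffOn_zero.2 fun x hx => (hg n x hx).continuousAt.continuousWithinAt
    | succ m ih =>
      intro n
      push_cast
      rw [contDiffOn_succ_iff_deriv_of_isOpen hs]
      exact ⟨fun x hx => (hg n x hx).differentiableAt.differentiableWithinAt, by simp,
        (ih (n + 1)).congr fun x hx => (hg n x hx).deriv⟩
  exact fun m => h m 0

/-- A series of entire functions is smooth on an open interval of the real line if the series of
derivatives of every order converge uniformly there. -/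
theorem contDiffOn_tsum_ofReal {f : ℕ → ℂ → ℂ} (hf : ∀ N, Differentiable ℂ (f N)) {s : Set ℝ}
    (hs : IsOpen s) (hs' : IsPreconnected s) {u : ℕ → ℕ → ℝ} (hu : ∀ n, Summable (u n))
    (hb : ∀ n N, ∀ x ∈ s, ‖iteratedDeriv n (f N) (x : ℂ)‖ ≤ u n N) :
    ContDiffOn ℝ (⊤ : ℕ∞) (fun x : ℝ => ∑' N, f N x) s := by
  have h := contDiffOn_of_hasDerivAt_succ hs
    (g := fun n x => ∑' N, iteratedDeriv n (f N) (x : ℂ)) fun n x hx => by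
      refine hasDerivAt_tsum_of_isPreconnected (hu (n + 1)) hs hs' (fun N y _ => ?_)
        (fun N y hy => hb (n + 1) N y hy) hx
        ((hu n).of_norm_bounded fun N => hb n N x hx) hx
      have hd : Differentiable ℂ (iteratedDeriv n (f N)) :=
        (hf N).contDiff.differentiable_iteratedDeriv (n := ⊤) n (WithTop.coe_lt_top _)
      simp only [iteratedDeriv_succ]
      exact (hd y).hasDerivAt.comp_ofReal
  simpa only [iteratedDeriv_zero] using h

theorem SuperPolyDecay.summable_rpow_mul {c : ℕ → ℝ} (hc : SuperPolyDecay c) (a : ℝ) :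
    Summable fun N : ℕ => (N : ℝ) ^ a * c N := by
  have h2 : Summable fun N : ℕ => (N : ℝ) ^ (-2 : ℝ) := Real.summable_nat_rpow.2 (by norm_num)
  refine h2.of_norm_bounded_eventually_nat ?_
  -- The exponent `a + 2` leaves the summable majorant `N ^ (-2)`.
  filter_upwards [hc.2.eventually_le_atBot (-(a + 2)), eventually_ge_atTop 2] with N hN hN2
  have hN0 : (0 : ℝ) < N := by exact_mod_cast (by omega : 0 < N)
  have hlog : 0 < Real.log N := Real.log_pos (by exact_mod_cast (by omega : 1 < N))
  rw [div_le_iff₀ hlog] at hN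
  have hcN : c N ≤ (N : ℝ) ^ (-(a + 2)) := by
    rw [Real.rpow_def_of_pos hN0, ← Real.exp_log (hc.1 N), Real.exp_le_exp, mul_comm]
    exact hN
  rw [Real.norm_of_nonneg (mul_nonneg (Real.rpow_nonneg hN0.le _) (hc.1 N).le)]
  calc (N : ℝ) ^ a * c N ≤ (N : ℝ) ^ a * (N : ℝ) ^ (-(a + 2)) :=
        mul_le_mul_of_nonneg_left hcN (Real.rpow_nonneg hN0.le _)
    _ = (N : ℝ) ^ (-2 : ℝ) := by rw [← Real.rpow_add hN0]; ring_nf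

theorem SuperPolyDecay.summable_add_two_rpow_mul {c : ℕ → ℝ} (hc : SuperPolyDecay c) {a : ℝ}
    (ha : 0 ≤ a) : Summable fun N : ℕ => ((N : ℝ) + 2) ^ a * c (N + 1) := by
  have h := ((summable_nat_add_iff 1).2 (hc.summable_rpow_mul a)).mul_left (2 ^ a)
  refine h.of_nonneg_of_le (fun N => mul_nonneg (by positivity) (hc.1 _).le) fun N => ?_
  rw [← mul_assoc, ← Real.mul_rpow (by norm_num) (by positivity)]
  refine mul_le_mul_of_nonneg_right ?_ (hc.1 _).le
  refine Real.rpow_le_rpow (by positivity) ?_ ha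
  push_cast
  linarith [(Nat.cast_nonneg N : (0 : ℝ) ≤ N)]

end Analysis

/-! ### Grouping clusters by the integer part of their capacity. -/

section CapacityClasses

theorem disjoint_clusterEvent {V Ω : Type*} {G : SimpleGraph V} {φ : V → Ω → ℝ} (X : Finset V) (h : ℝ) {K L : Finset V} (hKL : K ≠ L) :
    Disjoint (clusterEvent G φ X K h) (clusterEvent G φ X L h) := by
  rw [Set.disjoint_left]
  intro ω h1 h2
  exact hKL (Finset.coe_injective (Eq.trans (Eq.symm h1) h2))

variable {V : Type*} {G : SimpleGraph V} [G.LocallyFinite] {Ω : Type*}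
  {φ : V → Ω → ℝ}

/-- The integer part of `cap(K̄)`. -/
def capFloor (G : SimpleGraph V) [G.LocallyFinite] (K : Finset V) : ℕ :=
  ⌊cap G (vclosure G K)⌋₊

theorem cap_vclosure_lt (K : Finset V) : cap G (vclosure G K) < capFloor G K + 1 :=
  Nat.lt_floor_add_one _

theorem exploredCap_le (X K : Finset V) :
    exploredCap G X K ≤ capFloor G K + 1 + cap G X := by
  classical
  have h := cap_union_le (G := G) (vclosure G K) X
  have h2 := cap_vclosure_lt (G := G) K
  unfold exploredCap exploredSet
  convert (h.trans (add_le_add_left h2.le _)) using 2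

theorem PolyGrowth.exists_norm_le {F : Finset V → ℂ} (hF : PolyGrowth G F) :
    ∃ C : ℝ, 0 < C ∧ ∀ S, ‖F S‖ ≤ C * ((capFloor G S : ℝ) + 2) ^ C := by
  obtain ⟨C, hC, h⟩ := hF
  refine ⟨C, hC, fun S => (h S).trans ?_⟩
  have h1 := cap_vclosure_lt (G := G) S
  have h2 := cap_nonneg (G := G) (vclosure G S)
  exact mul_le_mul_of_nonneg_left
    (Real.rpow_le_rpow (by linarith) (by linarith) hC.le) hC.le

/-- Index shift: integer part `N` means capacity in `[N, N + 1)`, which is the event with index `N +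
1`. -/
theorem eventA_succ_eq_iUnion (X : Finset V) (N : ℕ) (h : ℝ) :
    eventA G φ X (N + 1) h
      = ⋃ K : {K : Finset V // capFloor G K = N}, clusterEvent G φ X K h := by
  have hiff : ∀ K : Finset V, capFloor G K = N ↔
      ((N + 1 : ℕ) : ℝ) - 1 ≤ cap G (vclosure G K) ∧ cap G (vclosure G K) < ((N + 1 : ℕ) : ℝ) := by
    intro K
    rw [capFloor, Nat.floor_eq_iff (cap_nonneg _)]
    push_cast
    rw [add_sub_cancel_right]
  ext ω
  simp only [eventA, mem_ofPred_eq, mem_iUnion, Subtype.exists, clusterEvent, exists_prop]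
  constructor
  · rintro ⟨hfin, hb⟩
    exact ⟨hfin.toFinset, (hiff _).2 hb, by simp⟩
  · rintro ⟨K, hK, hω⟩
    have hfin : (clusterUnion G φ X h ω).Finite := by rw [hω]; exact K.finite_toSet
    have : hfin.toFinset = K := by
      ext y; simp [hω]
    exact ⟨hfin, by rw [this]; exact (hiff K).1 hK⟩

variable [MeasurableSpace Ω] {P : Measure Ω} [Countable V]

theorem IsGFF.hasSum_measureReal_clusterEvent (hφ : IsGFF G φ P) (X : Finset V) (N : ℕ) (h : ℝ) :
    HasSum (fun K : {K : Finset V // capFloor G K = N} => P.real (clusterEvent G φ X K h))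
      (P.real (eventA G φ X (N + 1) h)) := by
  have := hφ.isGaussian.isProbabilityMeasure
  have hU : P (eventA G φ X (N + 1) h)
      = ∑' K : {K : Finset V // capFloor G K = N}, P (clusterEvent G φ X K h) := by
    rw [eventA_succ_eq_iUnion]
    refine measure_iUnion₀ (fun K L hKL => ?_) fun K => hφ.nullMeasurableSet_clusterEvent X K h
    exact (disjoint_clusterEvent X h fun hc => hKL (Subtype.ext hc)).aedisjoint
  have hne : ∑' K : {K : Finset V // capFloor G K = N}, P (clusterEvent G φ X K h) ≠ ∞ :=
    hU ▸ measure_ne_top _ _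
  have h2 := ENNReal.hasSum_toReal hne
  rw [← ENNReal.tsum_toReal_eq fun _ => measure_ne_top _ _, ← hU] at h2
  exact h2

/-- The entire extension of `h ↦ E[F(C_X(h)); N ≤ cap(K̄) < N + 1, K = C_X(h)]`. -/
def classExt (G : SimpleGraph V) [G.LocallyFinite] (φ : V → Ω → ℝ) (P : Measure Ω)
    (F : Finset V → ℂ) (X : Finset V) (N : ℕ) (z : ℂ) : ℂ :=
  ∑' K : {K : Finset V // capFloor G K = N}, F K * clusterProbExt G φ P X K z

variable {F : Finset V → ℂ} {C : ℝ}

theorem IsGFF.norm_classExt_term_le (htrans : IsTransient G) (hφ : IsGFF G φ P)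
    (hF : ∀ S, ‖F S‖ ≤ C * ((capFloor G S : ℝ) + 2) ^ C) (X : Finset V)
    {N : ℕ} (K : {K : Finset V // capFloor G K = N}) (z : ℂ) :
    ‖F K * clusterProbExt G φ P X K z‖ ≤ C * ((N : ℝ) + 2) ^ C *
      Real.exp (z.im ^ 2 * (N + 1 + cap G X) / 2) * P.real (clusterEvent G φ X K z.re) := by
  rw [norm_mul, mul_assoc]
  have h1 := hF K
  have h2 := exploredCap_le (G := G) X K
  rw [K.2] at h1 h2
  refine mul_le_mul h1 ((hφ.norm_clusterProbExt_le htrans X K z).trans ?_) (norm_nonneg _)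
    ((norm_nonneg _).trans h1)
  refine mul_le_mul_of_nonneg_right (Real.exp_le_exp.2 ?_) measureReal_nonneg
  have := mul_le_mul_of_nonneg_left h2 (sq_nonneg z.im)
  linarith

theorem IsGFF.norm_classExt_le (htrans : IsTransient G) (hφ : IsGFF G φ P)
    (hF : ∀ S, ‖F S‖ ≤ C * ((capFloor G S : ℝ) + 2) ^ C) (X : Finset V) (N : ℕ) (z : ℂ) :
    ‖classExt G φ P F X N z‖ ≤ C * ((N : ℝ) + 2) ^ C *
      Real.exp (z.im ^ 2 * (N + 1 + cap G X) / 2) * P.real (eventA G φ X (N + 1) z.re) :=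
  tsum_of_norm_bounded ((hφ.hasSum_measureReal_clusterEvent X N z.re).mul_left _)
    fun K => hφ.norm_classExt_term_le htrans hF X K z

/-- A class may contain infinitely many `K`. The Weierstrass test applies on a ball of radius `a`,
with majorants proportional to the probabilities at the two fixed levels `a` and `-a`. -/
theorem IsGFF.differentiable_classExt (htrans : IsTransient G) (hφ : IsGFF G φ P)
    (hF : ∀ S, ‖F S‖ ≤ C * ((capFloor G S : ℝ) + 2) ^ C) (X : Finset V) (N : ℕ) :
    Differentiable ℂ (classExt G φ P F X N) := by
  intro z₀
  set a := ‖z₀‖ + 1 with ha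
  have hX := cap_nonneg (G := G) X
  -- One exponential factor pays for the imaginary part of `z`, the other for moving its real part
  -- to `±a`.
  have hsum := ((hφ.hasSum_measureReal_clusterEvent X N a).add
    (hφ.hasSum_measureReal_clusterEvent X N (-a))).summable.mul_left
      (‖C * ((N : ℝ) + 2) ^ C‖ * Real.exp (a ^ 2 * (N + 1 + cap G X) / 2) *
        Real.exp (a ^ 2 * (N + 1 + cap G X) / 2))
  have hd := Complex.differentiableOn_tsum_of_summable_norm (U := Metric.ball 0 a) hsum
    (F := fun (K : {K : Finset V // capFloor G K = N}) z => F K * clusterProbExt G φ P X K z)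
    (fun K => ((hφ.differentiable_clusterProbExt htrans X K).const_mul (F K)).differentiableOn)
    Metric.isOpen_ball fun K z hz => by
      have hz' : ‖z‖ < a := by simpa using hz
      refine (hφ.norm_classExt_term_le htrans hF X K z).trans ?_
      rw [mul_assoc (_ * _) (Real.exp _) (_ + _)]
      have him : z.im ^ 2 ≤ a ^ 2 := sq_le_sq'
        (by linarith [(abs_le.1 (Complex.abs_im_le_norm z)).1])
        (by linarith [(abs_le.1 (Complex.abs_im_le_norm z)).2])
      refine mul_le_mul (mul_le_mul (le_abs_self _) (Real.exp_le_exp.2 (by gcongr))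
        (Real.exp_pos _).le (norm_nonneg _)) ?_ measureReal_nonneg (by positivity)
      refine (hφ.measureReal_clusterEvent_le_of_abs_le htrans X K
        ((Complex.abs_re_le_norm z).trans hz'.le)).trans ?_
      refine mul_le_mul_of_nonneg_right (Real.exp_le_exp.2 ?_)
        (add_nonneg measureReal_nonneg measureReal_nonneg)
      have h2 := exploredCap_le (G := G) X K
      rw [K.2] at h2
      gcongr
  exact hd.differentiableAt (Metric.isOpen_ball.mem_nhds (by simp [ha]))

theorem IsGFF.norm_iteratedDeriv_classExt_le (htrans : IsTransient G) (hφ : IsGFF G φ P)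
    (hC : 0 < C) (hF : ∀ S, ‖F S‖ ≤ C * ((capFloor G S : ℝ) + 2) ^ C) (X : Finset V)
    (n N : ℕ) {h r c : ℝ} (hr : 0 < r)
    (hc : ∀ s, |s - h| ≤ r → P.real (eventA G φ X (N + 1) s) ≤ c) :
    ‖iteratedDeriv n (classExt G φ P F X N) (h : ℂ)‖ ≤
      n.factorial * C * Real.exp (r ^ 2 / 2) * ((1 + cap G X) / r) ^ n *
        (((N : ℝ) + 2) ^ (C + n) * c) := by
  have hX := cap_nonneg (G := G) X
  set κ : ℝ := N + 1 + cap G X with hκ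
  have hN : (0 : ℝ) ≤ N := Nat.cast_nonneg N
  have hκ1 : 1 ≤ κ := by linarith
  have hκ0 : 0 < κ := by linarith
  have hc0 : 0 ≤ c := measureReal_nonneg.trans (hc h (by simpa using hr.le))
  have hR : r / κ ≤ r := div_le_self hr.le hκ1
  -- With radius `r / κ` the exponent is at most `(r / κ)² κ / 2 ≤ r² / 2`, uniformly in `N`, while
  -- dividing by the `n`-th power of the radius costs only a factor `(κ / r) ^ n`, polynomial in
  -- `N`.
  have hCauchy := Complex.norm_iteratedDeriv_le_of_forall_mem_sphere_norm_le (c := (h : ℂ))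
    (R := r / κ) (C := C * ((N : ℝ) + 2) ^ C * Real.exp (r ^ 2 / 2) * c) n (by positivity)
    (hφ.differentiable_classExt htrans hF X N).diffContOnCl fun z hz => by
      have hz' : ‖z - h‖ = r / κ := by simpa using hz
      have hre : |z.re - h| ≤ r := by
        have := Complex.abs_re_le_norm (z - h)
        simp only [Complex.sub_re, Complex.ofReal_re] at this
        linarith
      have him : |z.im| ≤ r / κ := by
        have := Complex.abs_im_le_norm (z - h)
        simp only [Complex.sub_im, Complex.ofReal_im, sub_zero] at this
        linarith
      refine (hφ.norm_classExt_le htrans hF X N z).trans ?_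
      refine mul_le_mul (mul_le_mul_of_nonneg_left (Real.exp_le_exp.2 ?_) (by positivity))
        (hc _ hre) measureReal_nonneg (by positivity)
      have h1 : z.im ^ 2 ≤ (r / κ) ^ 2 := sq_le_sq' (abs_le.1 him).1 (abs_le.1 him).2
      have h2 : (r / κ) ^ 2 * κ ≤ r ^ 2 := by
        rw [div_pow, div_mul_eq_mul_div, div_le_iff₀ (by positivity), pow_two κ]
        exact mul_le_mul_of_nonneg_left (by nlinarith) (sq_nonneg r)
      have h3 := mul_le_mul_of_nonneg_right h1 hκ0.le
      linarith
  refine hCauchy.trans ?_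
  have hκ2 : κ ≤ (N + 2) * (1 + cap G X) := by rw [hκ]; nlinarith
  calc n.factorial * (C * ((N : ℝ) + 2) ^ C * Real.exp (r ^ 2 / 2) * c) / (r / κ) ^ n
      = n.factorial * C * Real.exp (r ^ 2 / 2) * (((N : ℝ) + 2) ^ C * c) * (κ / r) ^ n := by
        rw [div_pow, div_pow]; field_simp
    _ ≤ n.factorial * C * Real.exp (r ^ 2 / 2) * (((N : ℝ) + 2) ^ C * c) *
          ((N + 2) * (1 + cap G X) / r) ^ n := by
        gcongr
    _ = _ := by
        rw [Real.rpow_add (by positivity), Real.rpow_natCast, mul_div_assoc, mul_pow]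
        ring

end CapacityClasses

/-! ### Integrability and smoothness of the observable. -/

section Observables

variable {V : Type*} {G : SimpleGraph V} {Ω : Type*} {φ : V → Ω → ℝ}

/-- At most one term is nonzero, and none is when the cluster is infinite. -/
theorem hasSum_observableValue (F : Finset V → ℂ) (X : Finset V) (h : ℝ) (ω : Ω) :
    HasSum (fun K : Finset V => (clusterEvent G φ X K h).indicator (fun _ => F K) ω)
      (observableValue G φ F X h ω) := by
  unfold observableValue
  split_ifs with hC
  · have hmem : ω ∈ clusterEvent G φ X hC.toFinset h := by simp [clusterEvent]
    convert hasSum_single hC.toFinset fun K hK => ?_ using 1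
    · rw [indicator_of_mem hmem]
    · exact indicator_of_notMem
        (fun hω => Set.disjoint_left.1 (disjoint_clusterEvent X h hK) hω hmem) _
  · convert hasSum_zero using 2 with K
    refine indicator_of_notMem (fun hω => hC ?_) _
    rw [show clusterUnion G φ X h ω = K from hω]
    exact K.finite_toSet

variable [G.LocallyFinite] [MeasurableSpace Ω] {P : Measure Ω}

/-- Lying strictly beyond a threshold leaves room for an admissible level in between, whose
half-line is a neighbourhood of `h`. -/
theorem exists_nhds_uniformDecayOn {o : V} {h : ℝ} (hh : h ∈ offThresholds G φ P o) :
    ∃ U ∈ 𝓝 h, UniformDecayOn G φ P U := by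
  have h' : (h : EReal) < hTilde G φ P o ∨ hHat G φ P o < (h : EReal) := by
    by_contra hcon
    simp only [not_or, not_lt] at hcon
    exact hh hcon
  rcases h' with h' | h'
  · obtain ⟨_, ⟨h₀, ⟨-, hd⟩, rfl⟩, hlt⟩ := lt_sSup_iff.1 h'
    exact ⟨Iic h₀, Iic_mem_nhds (EReal.coe_lt_coe_iff.1 hlt), hd⟩
  · obtain ⟨_, ⟨h₀, ⟨-, hd⟩, rfl⟩, hlt⟩ := sInf_lt_iff.1 h'
    exact ⟨Ici h₀, Ici_mem_nhds (EReal.coe_lt_coe_iff.1 hlt), hd⟩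

variable [Countable V] {F : Finset V → ℂ} {C : ℝ}

theorem IsGFF.summable_norm_mul_clusterEvent (hφ : IsGFF G φ P)
    (hF : ∀ S, ‖F S‖ ≤ C * ((capFloor G S : ℝ) + 2) ^ C) {X : Finset V} {h : ℝ}
    (hsum : Summable fun N : ℕ =>
      C * ((N : ℝ) + 2) ^ C * P.real (eventA G φ X (N + 1) h)) :
    Summable fun K : Finset V => ‖F K‖ * P.real (clusterEvent G φ X K h) := by
  rw [← (Equiv.sigmaFiberEquiv (capFloor G)).summable_iff]
  have hle : ∀ (N : ℕ) (K : {K : Finset V // capFloor G K = N}),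
      ‖F K‖ * P.real (clusterEvent G φ X K h)
        ≤ C * ((N : ℝ) + 2) ^ C * P.real (clusterEvent G φ X K h) := fun N K => by
    have h1 := hF K
    rw [K.2] at h1
    exact mul_le_mul_of_nonneg_right h1 measureReal_nonneg
  have hS : ∀ N : ℕ, HasSum (fun K : {K : Finset V // capFloor G K = N} =>
      C * ((N : ℝ) + 2) ^ C * P.real (clusterEvent G φ X K h)) _ := fun N =>
    (hφ.hasSum_measureReal_clusterEvent X N h).mul_left _
  have hN : ∀ N : ℕ, Summable fun K : {K : Finset V // capFloor G K = N} =>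
      ‖F K‖ * P.real (clusterEvent G φ X K h) := fun N =>
    (hS N).summable.of_nonneg_of_le
      (fun K => mul_nonneg (norm_nonneg _) measureReal_nonneg) (hle N)
  refine (summable_sigma_of_nonneg
    fun p => mul_nonneg (norm_nonneg _) measureReal_nonneg).2 ⟨hN, ?_⟩
  refine hsum.of_nonneg_of_le
    (fun N => tsum_nonneg fun K => mul_nonneg (norm_nonneg _) measureReal_nonneg) fun N => ?_
  exact ((hN N).tsum_le_tsum (hle N) (hS N).summable).trans_eq (hS N).tsum_eq

theorem IsGFF.integrable_observableValue (hφ : IsGFF G φ P) {X : Finset V} {h : ℝ}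
    (hsum : Summable fun K : Finset V => ‖F K‖ * P.real (clusterEvent G φ X K h)) :
    Integrable (fun ω => observableValue G φ F X h ω) P ∧
      HasSum (fun K => F K * (P.real (clusterEvent G φ X K h) : ℂ)) (FBar G φ P F X h) := by
  have := hφ.isGaussian.isProbabilityMeasure
  have hnull := fun K => hφ.nullMeasurableSet_clusterEvent X K h
  set g : Finset V → Ω → ℂ := fun K => (clusterEvent G φ X K h).indicator (fun _ => F K) with hg
  have hgi : ∀ K, Integrable (g K) P := fun K => (integrable_const _).indicator₀ (hnull K)
  have hnorm : ∀ K, ∫ ω, ‖g K ω‖ ∂P = ‖F K‖ * P.real (clusterEvent G φ X K h) := fun K => by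
    simp only [hg, norm_indicator_eq_indicator_norm]
    rw [integral_indicator₀ (hnull K), setIntegral_const, smul_eq_mul, mul_comm]
  have hint : ∀ K, ∫ ω, g K ω ∂P = F K * (P.real (clusterEvent G φ X K h) : ℂ) := fun K => by
    simp only [hg]
    rw [integral_indicator₀ (hnull K), setIntegral_const, Complex.real_smul, mul_comm]
  have htsum : ∀ ω, observableValue G φ F X h ω = ∑' K, g K ω := fun ω =>
    (hasSum_observableValue F X h ω).tsum_eq.symm
  have hs := hasSum_integral_of_summable_integral_norm hgi (by simpa only [hnorm] using hsum)
  refine ⟨⟨?_, ?_⟩, ?_⟩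
  · refine aestronglyMeasurable_of_tendsto_ae (atTop : Filter (Finset (Finset V)))
      (f := fun s ω => ∑ K ∈ s, g K ω) (fun s => ?_)
      (.of_forall fun ω => hasSum_observableValue F X h ω)
    exact Finset.aestronglyMeasurable_fun_sum s fun K _ => (hgi K).aestronglyMeasurable
  · have hle : ∀ ω, ‖observableValue G φ F X h ω‖ₑ ≤ ∑' K, ‖g K ω‖ₑ := fun ω => by
      rw [htsum]; exact enorm_tsum_le_tsum_enorm
    refine (lintegral_mono hle).trans_lt ?_
    rw [lintegral_tsum fun K => (hgi K).aestronglyMeasurable.enorm]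
    have : ∀ K, ∫⁻ ω, ‖g K ω‖ₑ ∂P = ENNReal.ofReal (‖F K‖ * P.real (clusterEvent G φ X K h)) :=
      fun K => by
        rw [← hnorm, ofReal_integral_norm_eq_lintegral_enorm (hgi K)]
    simp only [this]
    exact hsum.tsum_ofReal_lt_top
  · simp only [hint, ← htsum] at hs
    exact hs

theorem IsGFF.FBar_eq_tsum_classExt (htrans : IsTransient G) (hφ : IsGFF G φ P) {X : Finset V}
    {h : ℝ} (hsum : Summable fun K : Finset V => ‖F K‖ * P.real (clusterEvent G φ X K h)) :
    FBar G φ P F X h = ∑' N, classExt G φ P F X N h := by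
  have hs := (hφ.integrable_observableValue hsum).2
  rw [← (Equiv.sigmaFiberEquiv (capFloor G)).hasSum_iff] at hs
  rw [← hs.tsum_eq, hs.summable.tsum_sigma]
  refine tsum_congr fun N => tsum_congr fun K => ?_
  simp only [Function.comp_apply, Equiv.sigmaFiberEquiv_apply]
  rw [hφ.clusterProbExt_ofReal htrans]

theorem IsGFF.integrable_and_contDiffAt (htrans : IsTransient G) (hφ : IsGFF G φ P)
    (hF : PolyGrowth G F) (X : Finset V) {U : Set ℝ} (hU : UniformDecayOn G φ P U) {h : ℝ}
    (hh : U ∈ 𝓝 h) :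
    Integrable (fun ω => observableValue G φ F X h ω) P ∧
      ContDiffAt ℝ (⊤ : ℕ∞) (fun h : ℝ => FBar G φ P F X h) h := by
  obtain ⟨C, hC, hFC⟩ := hF.exists_norm_le
  obtain ⟨c, hc, hdecay⟩ := hU X
  obtain ⟨r, hr, hrU⟩ := Metric.mem_nhds_iff.1 hh
  have hX := cap_nonneg (G := G) X
  have hsum : ∀ s ∈ U, Summable fun K : Finset V => ‖F K‖ * P.real (clusterEvent G φ X K s) :=
    fun s hs => by
      refine hφ.summable_norm_mul_clusterEvent hFC (((hc.summable_add_two_rpow_mul hC.le).mul_left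
        C).of_nonneg_of_le (fun N => mul_nonneg (by positivity) measureReal_nonneg) fun N => ?_)
      rw [mul_assoc]
      gcongr
      exact hdecay (N + 1) (by omega) s hs
  refine ⟨(hφ.integrable_observableValue (hsum h (mem_of_mem_nhds hh))).1, ?_⟩
  have hsmooth : ContDiffOn ℝ (⊤ : ℕ∞)
      (fun x : ℝ => ∑' N, classExt G φ P F X N x) (Metric.ball h (r / 2)) := by
    -- Centres within `r / 2` of `h` and Cauchy discs of radius at most `r / 4` keep all real parts
    -- inside the ball of radius `r`, where the decay is uniform.
    refine contDiffOn_tsum_ofReal (fun N => hφ.differentiable_classExt htrans hFC X N)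
      Metric.isOpen_ball (convex_ball h (r / 2)).isPreconnected
      (fun n => (hc.summable_add_two_rpow_mul (a := C + n) (by positivity)).mul_left
        (n.factorial * C * Real.exp ((r / 4) ^ 2 / 2) * ((1 + cap G X) / (r / 4)) ^ n))
      fun n N x hx => ?_
    refine hφ.norm_iteratedDeriv_classExt_le htrans hC hFC X n N (by positivity) fun s hs =>
      hdecay (N + 1) (by omega) s (hrU ?_)
    have h1 : |x - h| < r / 2 := by simpa [Real.dist_eq] using hx
    rw [Metric.mem_ball, Real.dist_eq]
    have := abs_sub_le s x h
    linarith
  have hnhds : Metric.ball h (r / 2) ∈ 𝓝 h := Metric.ball_mem_nhds h (by positivity)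
  refine (hsmooth.contDiffAt hnhds).congr_of_eventuallyEq ?_
  filter_upwards [hh] with s hs
  exact hφ.FBar_eq_tsum_classExt htrans (hsum s hs)

end Observables

end GFFPerc

end

theorem theorem1p6 {V : Type*} (G : SimpleGraph V) [G.LocallyFinite]
    (hconn : G.Connected) (htrans : GFFPerc.IsTransient G)
    {Ω : Type*} [MeasurableSpace Ω] (P : Measure Ω) [IsProbabilityMeasure P]
    (φ : V → Ω → ℝ) (hφ : GFFPerc.IsGFF G φ P) (o : V)
    (F : Finset V → ℂ) (hF : GFFPerc.PolyGrowth G F) (X : Finset V) :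
    (∀ h ∈ GFFPerc.offThresholds G φ P o,
      Integrable (fun ω => GFFPerc.observableValue G φ F X h ω) P) ∧
    ContDiffOn ℝ (⊤ : ℕ∞) (fun h : ℝ => GFFPerc.FBar G φ P F X h)
      (GFFPerc.offThresholds G φ P o) := by
  have := GFFPerc.countable_of_connected hconn
  have key : ∀ h ∈ GFFPerc.offThresholds G φ P o,
      Integrable (fun ω => GFFPerc.observableValue G φ F X h ω) P ∧
        ContDiffAt ℝ (⊤ : ℕ∞) (fun h : ℝ => GFFPerc.FBar G φ P F X h) h := fun h hh => by
    obtain ⟨U, hUh, hU⟩ := GFFPerc.exists_nhds_uniformDecayOn hh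
    exact hφ.integrable_and_contDiffAt htrans hF X hU hUh
  exact ⟨fun h hh => (key h hh).1, fun h hh => (key h hh).2.contDiffWithinAt⟩
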